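/- Let $G$ be a (discrete) group and let $Y\subseteq G$ be a finite set with at least two elements which generates $G$ as a semigroup. Let $F:Y\to\mathbb R$ be a function and let $\beta\in\mathbb R$. For a finite word $t=(t_1,\dots,t_n)\in Y^n$, $n\ge 0$, put $\overline t=t_1t_2\cdots t_n\in G$ and $F(t)=\sum_{j=1}^nF(t_j)$ (so $\overline\emptyset=e_0$, the neutral element, and $F(\emptyset)=0$), and let $tY^{\mathbb N}\subseteq Y^{\mathbb N}$ be the cylinder set of the sequences that begin with $t$. Let $O_Y$ be the Cuntz algebra, i.e. the universal unital $C^*$-algebra generated by isometries $V_s$, $s\in Y$, with $V_s^*V_{s'}=0$ for $s\ne s'$ and $\sum_{s\in Y}V_sV_s^*=1$, and put $V_t=V_{t_1}\cdots V_{t_n}$. Let $O_Y(G)\subseteq O_Y$ be the $C^*$-subalgebra that is the closed linear span of the elements $V_tV_u^*$ with $\overline t=\overline u$, and let $\alpha^F$ be the one-parameter group of automorphisms of $O_Y(G)$ with $\alpha^F_r(V_tV_u^*)=e^{ir(F(t)-F(u))}V_tV_u^*$. Let $E:O_Y\to C(Y^{\mathbb N})$ be the conditional expectation with $E(V_tV_u^*)=1_{tY^{\mathbb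 N}}$ if $t=u$ and $E(V_tV_u^*)=0$ if $t\neq u$. A state $\omega$ on $O_Y(G)$ is a $\beta$-KMS state for $\alpha^F$ when there is a dense $\alpha^F$-invariant $*$-subalgebra $\mathcal A$ of $O_Y(G)$, consisting of (entire) analytic elements for $\alpha^F$, such that $\omega(ab)=\omega(b\,\alpha^F_{i\beta}(a))$ for all $a,b\in\mathcal A$. A Borel probability measure $m$ on $Y^{\mathbb N}$ is a $\beta$-KMS measure when the state $a\mapsto\int_{Y^{\mathbb N}}E(a)\,dm$ on $O_Y(G)$ is a $\beta$-KMS state. A normalized $\beta$-harmonic vector is a function $\psi:G\to[0,\infty)$ with $\psi_{e_0}=1$ and $\sum_{s\in Y}e^{-\beta F(s)}\psi_{gs}=\psi_g$ for all $g\in G$. The sets of these states, measures and vectors are given the weak* topology, the topology of weak convergence of measures (the weak* topology), and the topology of pointwise convergence, respectively. Then these three sets are convex, and there are affine homeomorphisms $m\mapsto\omega$ from the $\beta$-KMS measures onto the $\beta$-KMS states for $\alpha^F$, and $m\mapsto\psi$ from the $\beta$-KMS measures onto the normalized $\beta$-harmonic vectors on $G$ (hence, by composition, also between the $\beta$-KMS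 states and the normalized $\beta$-harmonic vectors), determined by $$\omega(a)=\int_{Y^{\mathbb N}}E(a)\,dm\quad (a\in O_Y(G)),\qquad m(tY^{\mathbb N})=e^{-\beta F(t)}\psi_{\overline t}\quad\Big(t\in\bigcup_{n\ge0}Y^n\Big).$$ -/

import Mathlib

noncomputable section

open scoped ENNReal

set_option linter.unusedSectionVars false

universe u

/-- A family `V_s`, `s ∈ Y`, of isometries in a nonzero unital C*-algebra satisfying the Cuntz
relations `V_s^* V_t = δ_{s,t} 1` and `∑_s V_s V_s^* = 1`. -/
structure CuntzFamily (Y : Type u) [Fintype Y] where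
  carrier : Type u
  [cstar : CStarAlgebra carrier]
  [nontriv : Nontrivial carrier]
  V : Y → carrier
  isometry : ∀ s, star (V s) * V s = 1
  orthogonal : ∀ s t, s ≠ t → star (V s) * V t = 0
  sum_range : ∑ s, V s * star (V s) = 1

attribute [instance] CuntzFamily.cstar CuntzFamily.nontriv

variable {Y : Type u} [Fintype Y]

/-- The C*-algebra of bounded elements in the product of the C*-algebras of all Cuntz families. -/
def CuntzProduct (Y : Type u) [Fintype Y] : Type (u + 1) :=
  lp (fun i : CuntzFamily Y => i.carrier) ∞

namespace CuntzProduct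

/-- The pointwise C*-algebra structure on the product (kept opaque to instance unification). -/
def cstarAux (Y : Type u) [Fintype Y] :
    CStarAlgebra (lp (fun i : CuntzFamily Y => i.carrier) ∞) where

instance : CStarAlgebra (CuntzProduct Y) := cstarAux Y

/-- Coordinate projection onto one Cuntz family. -/
def proj (i : CuntzFamily Y) : CuntzProduct Y →⋆ₐ[ℂ] i.carrier where
  toFun a := (show lp (fun i : CuntzFamily Y => i.carrier) ∞ from a) i
  map_one' := rfl
  map_mul' _ _ := rfl
  map_zero' := rfl
  map_add' _ _ := rfl
  commutes' _ := rfl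
  map_star' _ := rfl

theorem ext {a b : CuntzProduct Y} (h : ∀ i, proj i a = proj i b) : a = b :=
  lp.ext (funext h)

theorem norm_V (i : CuntzFamily Y) (s : Y) : ‖i.V s‖ ≤ 1 := by
  have h := CStarRing.norm_star_mul_self (x := i.V s)
  rw [i.isometry, CStarRing.norm_one] at h
  nlinarith [norm_nonneg (i.V s)]

/-- The universal generator: `V_s` in every coordinate. -/
def gen (s : Y) : CuntzProduct Y :=
  (⟨fun i => i.V s, memℓp_infty ⟨1, by rintro _ ⟨i, rfl⟩; exact norm_V i s⟩⟩ :
    lp (fun i : CuntzFamily Y => i.carrier) ∞)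

theorem proj_gen (i : CuntzFamily Y) (s : Y) : proj i (gen s) = i.V s := rfl

end CuntzProduct

/-- The Cuntz family `z_s V_s`, for complex numbers `z_s` of modulus one. -/
def CuntzFamily.twist (z : Y → Circle) (i : CuntzFamily Y) : CuntzFamily Y where
  carrier := i.carrier
  V s := (z s : ℂ) • i.V s
  isometry s := by
    rw [star_smul, smul_mul_smul_comm, i.isometry]
    simp [← Complex.normSq_eq_conj_mul_self]
  orthogonal s t h := by
    rw [star_smul, smul_mul_smul_comm, i.orthogonal s t h, smul_zero]
  sum_range := by
    rw [← i.sum_range]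
    refine Finset.sum_congr rfl fun s _ => ?_
    rw [star_smul, smul_mul_smul_comm]
    simp [Complex.mul_conj]

namespace CuntzProduct

/-- The `*`-endomorphism permuting the coordinates along `CuntzFamily.twist`; it maps `V_s` to
`z_s V_s`. -/
def twist (z : Y → Circle) : CuntzProduct Y →⋆ₐ[ℂ] CuntzProduct Y where
  toFun a := (⟨fun i => (proj (i.twist z) a : i.carrier), memℓp_infty (by
    obtain ⟨C, hC⟩ := memℓp_infty_iff.1 (lp.memℓp (show lp (fun i : CuntzFamily Y => i.carrier) ∞ from a))
    refine ⟨C, ?_⟩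
    rintro _ ⟨i, rfl⟩
    exact hC ⟨i.twist z, rfl⟩)⟩ : lp (fun i : CuntzFamily Y => i.carrier) ∞)
  map_one' := rfl
  map_mul' _ _ := rfl
  map_zero' := rfl
  map_add' _ _ := rfl
  commutes' _ := rfl
  map_star' _ := rfl

theorem twist_gen (z : Y → Circle) (s : Y) : twist z (gen s) = (z s : ℂ) • gen s := rfl

end CuntzProduct

section Words
variable {A : Type*} [CStarAlgebra A] {S : Type*} {H : Type*} [Group H]

/-- `V_t = V_{t_1} ⋯ V_{t_n}`. -/
def wordProd (V : S → A) (t : List S) : A := (t.map V).prod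

@[simp] theorem wordProd_nil (V : S → A) : wordProd V [] = 1 := rfl

@[simp] theorem wordProd_cons (V : S → A) (s : S) (t : List S) :
    wordProd V (s :: t) = V s * wordProd V t := List.prod_cons

theorem wordProd_append (V : S → A) (t u : List S) :
    wordProd V (t ++ u) = wordProd V t * wordProd V u := by
  simp [wordProd]

theorem star_wordProd_mul {V : S → A} (h1 : ∀ s, star (V s) * V s = 1)
    (h2 : ∀ s t, s ≠ t → star (V s) * V t = 0) (u t : List S) :
    star (wordProd V u) * wordProd V t = 0 ∨
      (∃ x, t = u ++ x ∧ star (wordProd V u) * wordProd V t = wordProd V x) ∨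
      (∃ x, u = t ++ x ∧ star (wordProd V u) * wordProd V t = star (wordProd V x)) := by
  induction u generalizing t with
  | nil => exact Or.inr (Or.inl ⟨t, by simp⟩)
  | cons a u ih =>
    cases t with
    | nil => exact Or.inr (Or.inr ⟨a :: u, by simp⟩)
    | cons b t =>
      have key : star (wordProd V (a :: u)) * wordProd V (b :: t) =
          star (wordProd V u) * (star (V a) * V b) * wordProd V t := by
        simp [mul_assoc]
      by_cases hab : a = b
      · subst hab
        rw [key, h1, mul_one]
        rcases ih t with h | ⟨x, hx, h⟩ | ⟨x, hx, h⟩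
        · exact Or.inl h
        · exact Or.inr (Or.inl ⟨x, by rw [hx]; rfl, h⟩)
        · exact Or.inr (Or.inr ⟨x, by rw [hx]; rfl, h⟩)
      · left
        rw [key, h2 a b hab]
        simp

/-- The elements `V_w V_u^*` with `w` and `u` evaluating to the same group element. -/
def wordSet (V : S → A) (ev : S → H) : Set A :=
  {a | ∃ w u : List S, (w.map ev).prod = (u.map ev).prod ∧
    a = wordProd V w * star (wordProd V u)}

theorem wordSet_mul {V : S → A} (h1 : ∀ s, star (V s) * V s = 1)
    (h2 : ∀ s t, s ≠ t → star (V s) * V t = 0) (ev : S → H) {a b : A}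
    (ha : a ∈ wordSet V ev) (hb : b ∈ wordSet V ev) : a * b = 0 ∨ a * b ∈ wordSet V ev := by
  obtain ⟨w, u, hwu, rfl⟩ := ha
  obtain ⟨t, z, htz, rfl⟩ := hb
  have key : wordProd V w * star (wordProd V u) * (wordProd V t * star (wordProd V z)) =
      wordProd V w * (star (wordProd V u) * wordProd V t) * star (wordProd V z) := by
    simp only [mul_assoc]
  rw [key]
  rcases star_wordProd_mul h1 h2 u t with h | ⟨x, hx, h⟩ | ⟨x, hx, h⟩
  · left; rw [h]; simp
  · right
    refine ⟨w ++ x, z, ?_, by rw [h, wordProd_append]⟩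
    rw [← htz, hx]; simp [hwu]
  · right
    refine ⟨w, z ++ x, ?_, by rw [h, wordProd_append, star_mul]; simp only [mul_assoc]⟩
    rw [hwu, hx]; simp [htz]

/-- The linear span of the `V_w V_u^*` with `w` and `u` evaluating to the same group element,
as a `*`-subalgebra. -/
def wordSpan (V : S → A) (h1 : ∀ s, star (V s) * V s = 1)
    (h2 : ∀ s t, s ≠ t → star (V s) * V t = 0) (ev : S → H) : StarSubalgebra ℂ A where
  carrier := Submodule.span ℂ (wordSet V ev)
  add_mem' := Submodule.add_mem _
  mul_mem' {a b} ha hb := by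
    have h := Submodule.mul_mem_mul ha hb
    rw [Submodule.span_mul_span] at h
    refine Submodule.span_le.2 ?_ h
    rintro _ ⟨x, hx, y, hy, rfl⟩
    rcases wordSet_mul h1 h2 ev hx hy with h0 | h0
    · simp [h0]
    · exact Submodule.subset_span h0
  algebraMap_mem' r := by
    rw [Algebra.algebraMap_eq_smul_one]
    exact Submodule.smul_mem _ _ (Submodule.subset_span ⟨[], [], rfl, by simp⟩)
  star_mem' {a} ha := by
    induction ha using Submodule.span_induction with
    | mem x hx =>
      obtain ⟨w, u, h, rfl⟩ := hx
      exact Submodule.subset_span ⟨u, w, h.symm, by simp⟩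
    | zero => simp
    | add x y _ _ hx hy => rw [star_add]; exact Submodule.add_mem _ hx hy
    | smul c x _ hx => rw [star_smul]; exact Submodule.smul_mem _ _ hx

theorem mem_wordSpan {V : S → A} {h1 : ∀ s, star (V s) * V s = 1}
    {h2 : ∀ s t, s ≠ t → star (V s) * V t = 0} {ev : S → H} {a : A} :
    a ∈ wordSpan V h1 h2 ev ↔ a ∈ Submodule.span ℂ (wordSet V ev) := Iff.rfl

end Words

theorem starAlgHom_star {A B : Type*} [CStarAlgebra A] [CStarAlgebra B] (f : A →⋆ₐ[ℂ] B) (a : A) :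
    f (star a) = star (f a) := map_star f a

theorem continuous_starAlgHom {A B : Type*} [CStarAlgebra A] [CStarAlgebra B] (f : A →⋆ₐ[ℂ] B) :
    Continuous f :=
  AddMonoidHomClass.continuous_of_bound f 1
    (by simpa using NonUnitalStarAlgHom.norm_apply_le f)

/-- The C*-subalgebra of the product generated by the universal generators. -/
def cuntzSubalgebra (Y : Type u) [Fintype Y] : StarSubalgebra ℂ (CuntzProduct Y) :=
  (StarAlgebra.adjoin ℂ (Set.range (CuntzProduct.gen (Y := Y)))).topologicalClosure

/-- The Cuntz algebra `O_Y`, i.e. the universal C*-algebra generated by a Cuntz family indexed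
by `Y`. -/
def CuntzAlgebra (Y : Type u) [Fintype Y] : Type (u + 1) := cuntzSubalgebra Y

namespace CuntzAlgebra

/-- The C*-algebra structure inherited from the product (kept opaque to instance unification). -/
def cstarAux (Y : Type u) [Fintype Y] : CStarAlgebra (cuntzSubalgebra Y) :=
  StarSubalgebra.cstarAlgebra (cuntzSubalgebra Y)
    (h_closed := StarSubalgebra.isClosed_topologicalClosure _)

instance : CStarAlgebra (CuntzAlgebra Y) := cstarAux Y

/-- The inclusion into the product. -/
def incl : CuntzAlgebra Y →⋆ₐ[ℂ] CuntzProduct Y where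
  toFun a := a.1
  map_one' := rfl
  map_mul' _ _ := rfl
  map_zero' := rfl
  map_add' _ _ := rfl
  commutes' _ := rfl
  map_star' _ := rfl

theorem isClosedEmbedding_incl : Topology.IsClosedEmbedding (incl (Y := Y)) :=
  (StarSubalgebra.isClosed_topologicalClosure
    (StarAlgebra.adjoin ℂ (Set.range (CuntzProduct.gen (Y := Y))))).isClosedEmbedding_subtypeVal

/-- The canonical isometry `V_s` of `O_Y`. -/
def gen (s : Y) : CuntzAlgebra Y :=
  ⟨CuntzProduct.gen s, StarSubalgebra.le_topologicalClosure _
    (StarAlgebra.subset_adjoin ℂ _ ⟨s, rfl⟩)⟩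

theorem incl_gen (s : Y) : incl (gen s) = CuntzProduct.gen s := rfl

theorem incl_injective : Function.Injective (incl (Y := Y)) := Subtype.val_injective

theorem star_gen_mul_gen (s : Y) : star (gen s) * gen s = 1 := by
  refine incl_injective (CuntzProduct.ext fun i => ?_)
  simpa [incl_gen, CuntzProduct.proj_gen, starAlgHom_star] using i.isometry s

theorem star_gen_mul_gen_of_ne (s t : Y) (h : s ≠ t) : star (gen s) * gen t = 0 := by
  refine incl_injective (CuntzProduct.ext fun i => ?_)
  simpa [incl_gen, CuntzProduct.proj_gen, starAlgHom_star] using i.orthogonal s t h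

theorem sum_gen_mul_star_gen : ∑ s : Y, gen s * star (gen s) = 1 := by
  refine incl_injective (CuntzProduct.ext fun i => ?_)
  simpa [incl_gen, CuntzProduct.proj_gen, starAlgHom_star] using i.sum_range

/-- The universal property: every Cuntz family is the image of the canonical one under a
`*`-homomorphism from `O_Y`. -/
def lift (i : CuntzFamily Y) : CuntzAlgebra Y →⋆ₐ[ℂ] i.carrier := (CuntzProduct.proj i).comp incl

theorem lift_gen (i : CuntzFamily Y) (s : Y) : lift i (gen s) = i.V s := rfl

/-- `O_Y` is generated by the `V_s`. -/
theorem eq_top_of_gen_mem (S : StarSubalgebra ℂ (CuntzAlgebra Y))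
    (hS : IsClosed (S : Set (CuntzAlgebra Y))) (h : ∀ s, gen s ∈ S) : S = ⊤ := by
  have h1 : cuntzSubalgebra Y ≤ S.map incl := by
    refine StarSubalgebra.topologicalClosure_minimal ?_ ?_
    · rw [StarAlgebra.adjoin_le_iff]
      rintro _ ⟨s, rfl⟩
      exact ⟨gen s, h s, rfl⟩
    · have := isClosedEmbedding_incl.isClosedMap _ hS
      simpa using this
  refine eq_top_iff.2 fun a _ => ?_
  obtain ⟨b, hb, hba⟩ := h1 a.2
  have : b = a := incl_injective hba
  exact this ▸ hb

theorem closure_words_eq_top :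
    (wordSpan gen star_gen_mul_gen star_gen_mul_gen_of_ne (H := Multiplicative (Fin 1)) (fun _ : Y => 1)).topologicalClosure
      = ⊤ := by
  refine eq_top_of_gen_mem _ (StarSubalgebra.isClosed_topologicalClosure _) fun s => ?_
  refine StarSubalgebra.le_topologicalClosure _ (Submodule.subset_span ⟨[s], [], ?_, ?_⟩)
  · simp
  · simp

theorem twist_incl_mem (z : Y → Circle) (a : CuntzAlgebra Y) :
    CuntzProduct.twist z (incl a) ∈ cuntzSubalgebra Y := by
  have h : (cuntzSubalgebra Y).comap ((CuntzProduct.twist z).comp incl) = ⊤ := by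
    refine eq_top_of_gen_mem _ ?_ ?_
    · exact (StarSubalgebra.isClosed_topologicalClosure _).preimage
        (continuous_starAlgHom ((CuntzProduct.twist z).comp incl))
    · intro s
      change (z s : ℂ) • CuntzProduct.gen s ∈ cuntzSubalgebra Y
      exact SMulMemClass.smul_mem _ (gen s).2
  have ha : a ∈ (⊤ : StarSubalgebra ℂ (CuntzAlgebra Y)) := trivial
  rw [← h] at ha
  exact ha

/-- The `*`-endomorphism of the Cuntz algebra with `V_s ↦ z_s V_s`. -/
def gaugeHom (z : Y → Circle) : CuntzAlgebra Y →⋆ₐ[ℂ] CuntzAlgebra Y where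
  toFun a := ⟨CuntzProduct.twist z (incl a), twist_incl_mem z a⟩
  map_one' := rfl
  map_mul' _ _ := rfl
  map_zero' := rfl
  map_add' _ _ := rfl
  commutes' _ := rfl
  map_star' _ := rfl

theorem gaugeHom_gen (z : Y → Circle) (s : Y) : gaugeHom z (gen s) = (z s : ℂ) • gen s := rfl

theorem hom_ext {B : Type*} [CStarAlgebra B] {f g : CuntzAlgebra Y →⋆ₐ[ℂ] B}
    (h : ∀ s, f (gen s) = g (gen s)) : f = g := by
  have : StarAlgHom.equalizer f g = ⊤ :=
    eq_top_of_gen_mem _ (isClosed_eq (continuous_starAlgHom f) (continuous_starAlgHom g)) h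
  refine StarAlgHom.ext fun a => ?_
  have ha : a ∈ (⊤ : StarSubalgebra ℂ (CuntzAlgebra Y)) := trivial
  rw [← this] at ha
  exact ha

theorem gaugeHom_comp (z w : Y → Circle) :
    (gaugeHom z).comp (gaugeHom w) = gaugeHom (fun s => w s * z s) := by
  refine hom_ext fun s => ?_
  simp [gaugeHom_gen, smul_smul]

theorem gaugeHom_one : gaugeHom (fun _ : Y => 1) = StarAlgHom.id ℂ _ := by
  refine hom_ext fun s => ?_
  simp [gaugeHom_gen]

/-- The automorphism `α^F_t` of `O_Y`, with `α^F_t(V_s) = e^{itF(s)} V_s`. -/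
def gauge (F : Y → ℝ) (t : ℝ) : CuntzAlgebra Y ≃⋆ₐ[ℂ] CuntzAlgebra Y :=
  StarAlgEquiv.ofStarAlgHom (gaugeHom fun s => Circle.exp (t * F s))
    (gaugeHom fun s => Circle.exp (-(t * F s)))
    (by rw [gaugeHom_comp, ← gaugeHom_one]; congr; ext s; simp)
    (by rw [gaugeHom_comp, ← gaugeHom_one]; congr; ext s; simp)

theorem gauge_gen (F : Y → ℝ) (t : ℝ) (s : Y) :
    gauge F t (gen s) = Complex.exp (Complex.I * t * F s) • gen s := by
  change (Circle.exp (t * F s) : ℂ) • gen s = _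
  rw [Circle.coe_exp]
  push_cast
  ring_nf

theorem gauge_wordProd (F : Y → ℝ) (t : ℝ) (w : List Y) :
    gauge F t (wordProd gen w) =
      Complex.exp (Complex.I * t * ((w.map F).sum : ℝ)) • wordProd gen w := by
  induction w with
  | nil => simp
  | cons s w ih =>
    rw [wordProd_cons, map_mul, ih, gauge_gen, smul_mul_smul_comm, ← Complex.exp_add]
    simp [mul_add]

theorem gauge_word (F : Y → ℝ) (t : ℝ) (w u : List Y) :
    gauge F t (wordProd gen w * star (wordProd gen u)) =
      Complex.exp (Complex.I * t * ((w.map F).sum - (u.map F).sum : ℝ)) •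
        (wordProd gen w * star (wordProd gen u)) := by
  rw [map_mul, map_star, gauge_wordProd, gauge_wordProd, star_smul, smul_mul_smul_comm]
  congr 1
  rw [Complex.star_def, ← Complex.exp_conj, ← Complex.exp_add]
  congr 1
  simp
  ring

/-- The closed span in `O_Y` of the `V_w V_u^*` with `w` and `u` evaluating to the same group
element. -/
def groupSubalgebra {H : Type*} [Group H] (ev : Y → H) : StarSubalgebra ℂ (CuntzAlgebra Y) :=
  (wordSpan gen star_gen_mul_gen star_gen_mul_gen_of_ne ev).topologicalClosure

theorem continuous_gauge (F : Y → ℝ) (t : ℝ) : Continuous (gauge F t) :=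
  continuous_starAlgHom (gaugeHom _)

theorem gauge_mem {H : Type*} [Group H] (ev : Y → H) (F : Y → ℝ) (t : ℝ) {a : CuntzAlgebra Y}
    (ha : a ∈ groupSubalgebra ev) : gauge F t a ∈ groupSubalgebra ev := by
  suffices h : groupSubalgebra ev ≤
      (groupSubalgebra ev).comap (gauge F t : CuntzAlgebra Y →⋆ₐ[ℂ] CuntzAlgebra Y) from h ha
  refine StarSubalgebra.topologicalClosure_minimal ?_ ?_
  · intro a ha
    rw [mem_wordSpan] at ha
    refine StarSubalgebra.le_topologicalClosure _ ?_
    rw [mem_wordSpan]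
    change gauge F t a ∈ _
    induction ha using Submodule.span_induction with
    | mem x hx =>
      obtain ⟨w, u, h, rfl⟩ := hx
      rw [gauge_word]
      exact Submodule.smul_mem _ _ (Submodule.subset_span ⟨w, u, h, rfl⟩)
    | zero => rw [map_zero]; exact Submodule.zero_mem _
    | add x y _ _ hx hy => rw [map_add]; exact Submodule.add_mem _ hx hy
    | smul c x _ hx => rw [map_smul]; exact Submodule.smul_mem _ _ hx
  · exact (StarSubalgebra.isClosed_topologicalClosure _).preimage (continuous_gauge F t)

theorem gauge_zero (F : Y → ℝ) (a : CuntzAlgebra Y) : gauge F 0 a = a := by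
  have : gaugeHom (fun s => Circle.exp (0 * F s)) = StarAlgHom.id ℂ (CuntzAlgebra Y) := by
    rw [← gaugeHom_one]; congr; ext s; simp
  exact DFunLike.congr_fun this a

theorem gauge_add (F : Y → ℝ) (r t : ℝ) (a : CuntzAlgebra Y) :
    gauge F (r + t) a = gauge F r (gauge F t a) := by
  have : gaugeHom (fun s => Circle.exp ((r + t) * F s)) =
      (gaugeHom (fun s => Circle.exp (r * F s))).comp
        (gaugeHom (fun s => Circle.exp (t * F s))) := by
    rw [gaugeHom_comp]; congr; ext s; simp [← Circle.exp_add]; ring_nf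
  exact DFunLike.congr_fun this a
end CuntzAlgebra

/-- The algebra `O_Y(G)`, for letters `Y` evaluated in a group by `ev`. -/
def CayleyCuntz {H : Type*} [Group H] (ev : Y → H) : Type (u + 1) :=
  CuntzAlgebra.groupSubalgebra ev

namespace CayleyCuntz
variable {H : Type*} [Group H] {ev : Y → H}

/-- The C*-algebra structure inherited from `O_Y` (kept opaque to instance unification). -/
def cstarAux {H : Type*} [Group H] (ev : Y → H) : CStarAlgebra (CuntzAlgebra.groupSubalgebra ev) :=
  StarSubalgebra.cstarAlgebra (CuntzAlgebra.groupSubalgebra ev)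
    (h_closed := StarSubalgebra.isClosed_topologicalClosure _)

instance : CStarAlgebra (CayleyCuntz ev) := cstarAux ev

/-- The inclusion `O_Y(G) ⊆ O_Y`. -/
def incl : CayleyCuntz ev →⋆ₐ[ℂ] CuntzAlgebra Y where
  toFun a := a.1
  map_one' := rfl
  map_mul' _ _ := rfl
  map_zero' := rfl
  map_add' _ _ := rfl
  commutes' _ := rfl
  map_star' _ := rfl

/-- The restriction of `α^F_t` to `O_Y(G)`. -/
def gauge (F : Y → ℝ) (t : ℝ) : CayleyCuntz ev ≃⋆ₐ[ℂ] CayleyCuntz ev where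
  toFun a := ⟨CuntzAlgebra.gauge F t a.1, CuntzAlgebra.gauge_mem ev F t a.2⟩
  invFun a := ⟨CuntzAlgebra.gauge F (-t) a.1, CuntzAlgebra.gauge_mem ev F (-t) a.2⟩
  left_inv a := Subtype.ext (by
    change CuntzAlgebra.gauge F (-t) (CuntzAlgebra.gauge F t a.1) = a.1
    rw [← CuntzAlgebra.gauge_add, neg_add_cancel, CuntzAlgebra.gauge_zero])
  right_inv a := Subtype.ext (by
    change CuntzAlgebra.gauge F t (CuntzAlgebra.gauge F (-t) a.1) = a.1
    rw [← CuntzAlgebra.gauge_add, add_neg_cancel, CuntzAlgebra.gauge_zero])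
  map_mul' _ _ := rfl
  map_add' _ _ := rfl
  map_smul' _ _ := rfl
  map_star' _ := rfl

theorem incl_gauge (F : Y → ℝ) (t : ℝ) (a : CayleyCuntz ev) :
    incl (gauge F t a) = CuntzAlgebra.gauge F t (incl a) := rfl

end CayleyCuntz

/-- The compact space `Y^ℕ` of infinite sequences in the finite discrete set `Y`. -/
def PathSpace (Y : Type*) : Type _ := ℕ → Y

namespace PathSpace

instance (Y : Type*) : TopologicalSpace (PathSpace Y) :=
  @Pi.topologicalSpace ℕ (fun _ => Y) fun _ => ⊥

instance (Y : Type*) : MeasurableSpace (PathSpace Y) := borel _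

instance (Y : Type*) : BorelSpace (PathSpace Y) := ⟨rfl⟩

instance (Y : Type*) [Finite Y] : CompactSpace (PathSpace Y) := by
  letI : TopologicalSpace Y := ⊥
  exact inferInstanceAs (CompactSpace (ℕ → Y))

variable {S : Type*}

/-- The cylinder set `tY^ℕ`. -/
def cylinder (t : List S) : Set (PathSpace S) := {x | ∀ i : Fin t.length, x i = t.get i}

/-- The sequence `sx`. -/
def cons (s : S) (x : PathSpace S) : PathSpace S := fun n => Nat.casesOn n s x

/-- The sequence with its first letter removed. -/
def tail (x : PathSpace S) : PathSpace S := fun n => x (n + 1)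

theorem cons_tail (x : PathSpace S) : cons (x 0) (tail x) = x := by
  funext n; cases n <;> rfl

theorem cons_injective {s : S} {x y : PathSpace S} (h : cons s x = cons s y) : x = y := by
  funext n; exact congrFun h (n + 1)

theorem mem_cylinder_cons {s : S} {t : List S} {x : PathSpace S} :
    x ∈ cylinder (s :: t) ↔ x 0 = s ∧ tail x ∈ cylinder t := by
  constructor
  · intro h
    exact ⟨h ⟨0, by simp⟩, fun i => h ⟨i + 1, by simp⟩⟩
  · rintro ⟨h0, h⟩ ⟨i, hi⟩
    cases i with
    | zero => exact h0
    | succ i => exact h ⟨i, by simpa using hi⟩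

theorem mem_cylinder_nil {x : PathSpace S} : x ∈ cylinder ([] : List S) :=
  fun i => i.elim0

theorem eq_of_mem_cylinder {t u : List S} {x : PathSpace S} (ht : x ∈ cylinder t)
    (hu : x ∈ cylinder u) (h : t.length = u.length) : t = u := by
  refine List.ext_get h fun n h1 h2 => ?_
  exact (ht ⟨n, h1⟩).symm.trans (hu ⟨n, h2⟩)

theorem isClopen_cylinder (t : List S) : IsClopen (cylinder t) := by
  letI : TopologicalSpace S := ⊥
  haveI : DiscreteTopology S := ⟨rfl⟩
  have h : cylinder t = ⋂ i : Fin t.length, {x : PathSpace S | x i = t.get i} := by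
    ext x; simp [cylinder]
  rw [h]
  refine isClopen_iInter_of_finite fun i => ?_
  exact (isClopen_discrete {t.get i}).preimage
    (show Continuous fun x : PathSpace S => x i from continuous_apply (A := fun _ : ℕ => S) (i : ℕ))

end PathSpace

namespace PathRep

/-- The index set of the basis. -/
abbrev Index (Y : Type u) : Type u := PathSpace Y × ℤ

/-- The Hilbert space `ℓ²(Y^ℕ × ℤ)`. -/
abbrev Hilb (Y : Type u) : Type u := lp (fun _ : Index Y => ℂ) 2

open scoped Classical in
/-- The standard orthonormal basis. -/
def δ (i : Index Y) : Hilb Y := lp.single 2 i (1 : ℂ)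

theorem inner_δ (i : Index Y) (f : Hilb Y) : inner ℂ (δ i) f = f i := by
  classical
  unfold δ
  rw [lp.inner_single_left]
  simp

open scoped Classical in
theorem δ_apply (i j : Index Y) : (δ i : Hilb Y) j = if i = j then 1 else 0 := by
  unfold δ
  rw [lp.single_apply, Pi.single_apply]
  simp [eq_comm]

theorem orthonormal_δ : Orthonormal ℂ (δ (Y := Y)) := by
  classical
  rw [orthonormal_iff_ite]
  intro i j
  rw [inner_δ, δ_apply]
  simp [eq_comm]

theorem ext_vec {f g : Hilb Y} (h : ∀ i, inner ℂ (δ i) f = inner ℂ (δ i) g) : f = g :=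
  lp.ext (funext fun i => by simpa [inner_δ] using h i)

theorem ext_op {f g : Hilb Y →L[ℂ] Hilb Y} (h : ∀ i, f (δ i) = g (δ i)) : f = g := by
  classical
  refine lp.ext_continuousLinearMap (ENNReal.ofNat_ne_top (n := nat_lit 2)) fun i => ?_
  ext1
  have := h i
  simpa [δ] using this

/-- `(x, k) ↦ (sx, k + 1)`. -/
def shift (s : Y) (i : Index Y) : Index Y := (PathSpace.cons s i.1, i.2 + 1)

theorem shift_injective (s : Y) : Function.Injective (shift s) := by
  rintro ⟨x, k⟩ ⟨y, l⟩ h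
  simp only [shift, Prod.mk.injEq, add_left_inj] at h
  exact Prod.ext (PathSpace.cons_injective h.1) h.2

/-- The isometry `δ_i ↦ δ_{shift s i}`. -/
def isom (s : Y) : Hilb Y →ₗᵢ[ℂ] Hilb Y :=
  (orthonormal_δ.comp (shift s) (shift_injective s)).orthogonalFamily.linearIsometry

theorem isom_δ (s : Y) (i : Index Y) : isom s (δ i) = δ (shift s i) := by
  classical
  have := (orthonormal_δ.comp (shift s) (shift_injective s)).orthogonalFamily.linearIsometry_apply_single
    (i := i) (1 : ℂ)
  simpa [isom, δ] using this

/-- The same isometry as an operator. -/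
def op (s : Y) : Hilb Y →L[ℂ] Hilb Y := (isom s).toContinuousLinearMap

theorem op_δ (s : Y) (i : Index Y) : op s (δ i) = δ (shift s i) := isom_δ s i

theorem star_op_mul_op (s : Y) : star (op s) * op s = 1 :=
  (ContinuousLinearMap.norm_map_iff_adjoint_comp_self (op s)).1 (isom s).norm_map

theorem star_op_mul_op_of_ne (s t : Y) (h : s ≠ t) : star (op s) * op t = 0 := by
  classical
  refine ext_op fun i => ext_vec fun j => ?_
  rw [ContinuousLinearMap.mul_apply, ContinuousLinearMap.star_eq_adjoint,
    ContinuousLinearMap.adjoint_inner_right, op_δ, op_δ, inner_δ, δ_apply, if_neg]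
  · simp
  · intro h'
    exact h (congrFun (congrArg Prod.fst h') 0).symm

open scoped Classical in
theorem star_op_δ (s : Y) (x : PathSpace Y) (k : ℤ) :
    star (op s) (δ (x, k)) = if x 0 = s then δ (PathSpace.tail x, k - 1) else 0 := by
  have h : (δ (x, k) : Hilb Y) = op (x 0) (δ (PathSpace.tail x, k - 1)) := by
    rw [op_δ]
    simp [shift, PathSpace.cons_tail]
  rw [h, ← ContinuousLinearMap.mul_apply]
  split_ifs with hs
  · subst hs
    rw [star_op_mul_op]; rfl
  · rw [star_op_mul_op_of_ne _ _ (Ne.symm hs)]; rfl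

theorem sum_op (Y : Type u) [Fintype Y] : ∑ s : Y, op s * star (op s) = 1 := by
  classical
  refine ext_op fun i => ?_
  obtain ⟨x, k⟩ := i
  simp only [ContinuousLinearMap.sum_apply, ContinuousLinearMap.mul_apply, star_op_δ]
  rw [Finset.sum_eq_single (x 0)]
  · simp [op_δ, shift, PathSpace.cons_tail]
  · intro s _ hs
    simp [Ne.symm hs]
  · simp

/-- The Cuntz family on `ℓ²(Y^ℕ × ℤ)` given by `V_s δ_{(x, k)} = δ_{(sx, k + 1)}`. -/
def family (h : Nonempty Y) : CuntzFamily Y where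
  carrier := Hilb Y →L[ℂ] Hilb Y
  nontriv := by
    obtain ⟨y⟩ := h
    haveI : Nontrivial (Hilb Y) :=
      ⟨δ (fun _ => y, 0), 0, (orthonormal_δ.ne_zero _)⟩
    infer_instance
  V := op
  isometry := star_op_mul_op
  orthogonal := star_op_mul_op_of_ne
  sum_range := sum_op Y

/-- The corresponding representation of `O_Y`. -/
def rep (h : Nonempty Y) : CuntzAlgebra Y →⋆ₐ[ℂ] (Hilb Y →L[ℂ] Hilb Y) :=
  CuntzAlgebra.lift (family h)

theorem rep_gen (h : Nonempty Y) (s : Y) : rep h (CuntzAlgebra.gen s) = op s := rfl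

theorem rep_wordProd (h : Nonempty Y) (t : List Y) :
    rep h (wordProd CuntzAlgebra.gen t) = wordProd op t := by
  induction t with
  | nil => simp
  | cons s t ih => rw [wordProd_cons, wordProd_cons, map_mul, ih, rep_gen]

open scoped Classical in
theorem star_wordProd_δ (t : List Y) (x : PathSpace Y) (k : ℤ) :
    star (wordProd op t) (δ (x, k)) = if x ∈ PathSpace.cylinder t then
      δ (PathSpace.tail^[t.length] x, k - t.length) else 0 := by
  induction t generalizing x k with
  | nil => simp [PathSpace.mem_cylinder_nil]
  | cons s t ih =>
    rw [wordProd_cons, star_mul, ContinuousLinearMap.mul_apply, star_op_δ]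
    simp only [PathSpace.mem_cylinder_cons]
    by_cases hs : x 0 = s
    · simp [hs, ih]
      congr 3
      ring
    · simp [hs]

/-- The diagonal coefficient `⟨δ_{(x, 0)}, a δ_{(x, 0)}⟩`. -/
def diag (a : CuntzAlgebra Y) (x : PathSpace Y) : ℂ :=
  inner ℂ (δ (x, (0 : ℤ))) (rep ⟨x 0⟩ a (δ (x, (0 : ℤ))))

open scoped Classical in
theorem diag_word (t u : List Y) (x : PathSpace Y) :
    diag (wordProd CuntzAlgebra.gen t * star (wordProd CuntzAlgebra.gen u)) x =
      if t = u ∧ x ∈ PathSpace.cylinder t then 1 else 0 := by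
  rw [diag, map_mul, starAlgHom_star, rep_wordProd, rep_wordProd, ContinuousLinearMap.mul_apply,
    ← ContinuousLinearMap.adjoint_inner_left, ← ContinuousLinearMap.star_eq_adjoint,
    star_wordProd_δ, star_wordProd_δ]
  by_cases ht : x ∈ PathSpace.cylinder t
  · by_cases hu : x ∈ PathSpace.cylinder u
    · rw [if_pos ht, if_pos hu, inner_δ, δ_apply]
      by_cases htu : t = u
      · subst htu; simp [ht]
      · rw [if_neg, if_neg (by tauto)]
        intro h
        refine htu (PathSpace.eq_of_mem_cylinder ht hu ?_)
        have := congrArg Prod.snd h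
        simp at this
        omega
    · have : t ≠ u := by rintro rfl; exact hu ht
      simp [hu, this]
  · simp [ht]

theorem norm_diag_le (a : CuntzAlgebra Y) (x : PathSpace Y) : ‖diag a x‖ ≤ ‖a‖ := by
  have h1 : ‖(δ (x, (0 : ℤ)) : Hilb Y)‖ = 1 := orthonormal_δ.1 _
  calc ‖diag a x‖ ≤ ‖(δ (x, (0 : ℤ)) : Hilb Y)‖ * ‖rep ⟨x 0⟩ a (δ (x, (0 : ℤ)))‖ :=
        norm_inner_le_norm _ _
    _ ≤ 1 * (‖rep ⟨x 0⟩ a‖ * 1) := by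
        rw [h1]
        gcongr
        simpa [h1] using (rep ⟨x 0⟩ a).le_opNorm (δ (x, (0 : ℤ)))
    _ ≤ ‖a‖ := by
        simpa using NonUnitalStarAlgHom.norm_apply_le (rep ⟨x 0⟩) a

theorem diag_add (a b : CuntzAlgebra Y) (x : PathSpace Y) :
    diag (a + b) x = diag a x + diag b x := by
  simp [diag, inner_add_right]

theorem diag_smul (c : ℂ) (a : CuntzAlgebra Y) (x : PathSpace Y) :
    diag (c • a) x = c * diag a x := by
  simp only [diag]
  rw [map_smul, ContinuousLinearMap.smul_apply, inner_smul_right]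

theorem diag_sub (a b : CuntzAlgebra Y) (x : PathSpace Y) :
    diag (a - b) x = diag a x - diag b x := by
  simp [diag, inner_sub_right]

theorem continuous_diag (a : CuntzAlgebra Y) : Continuous (diag a) := by
  have hcl : a ∈ closure ((wordSpan CuntzAlgebra.gen CuntzAlgebra.star_gen_mul_gen
      CuntzAlgebra.star_gen_mul_gen_of_ne (H := Multiplicative (Fin 1)) (fun _ : Y => 1) :
      StarSubalgebra ℂ (CuntzAlgebra Y)) : Set (CuntzAlgebra Y)) := by
    have h : a ∈ (⊤ : StarSubalgebra ℂ (CuntzAlgebra Y)) := trivial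
    rw [← CuntzAlgebra.closure_words_eq_top] at h
    exact h
  obtain ⟨b, hb, hlim⟩ := mem_closure_iff_seq_limit.1 hcl
  have hu : TendstoUniformly (fun n => diag (b n)) (diag a) Filter.atTop := by
    rw [Metric.tendstoUniformly_iff]
    intro ε hε
    filter_upwards [Metric.tendsto_atTop.1 hlim ε hε |> fun ⟨N, hN⟩ =>
      Filter.eventually_atTop.2 ⟨N, hN⟩] with n hn x
    rw [dist_eq_norm, ← diag_sub]
    refine (norm_diag_le _ x).trans_lt ?_
    rwa [dist_comm, dist_eq_norm] at hn
  refine hu.continuous (Filter.Eventually.frequently (Filter.Eventually.of_forall fun n => ?_))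
  have hbn := hb n
  rw [SetLike.mem_coe, mem_wordSpan] at hbn
  change Continuous (diag (b n))
  generalize b n = bn at hbn ⊢
  induction hbn using Submodule.span_induction with
  | mem y hy =>
    classical
    obtain ⟨t, u, _, rfl⟩ := hy
    have : diag (wordProd CuntzAlgebra.gen t * star (wordProd CuntzAlgebra.gen u)) =
        fun x => if t = u ∧ x ∈ PathSpace.cylinder t then 1 else 0 := funext (diag_word t u)
    rw [this]
    by_cases htu : t = u
    · have h2 : (fun x : PathSpace Y => if t = u ∧ x ∈ PathSpace.cylinder t then (1 : ℂ) else 0) =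
          (PathSpace.cylinder t).indicator 1 := by
        funext x; simp [htu, Set.indicator_apply]
      rw [h2]
      exact (PathSpace.isClopen_cylinder t).continuous_indicator continuous_one
    · simpa [htu] using continuous_const
  | zero =>
    have : diag (0 : CuntzAlgebra Y) = 0 := by funext x; simp [diag]
    rw [this]; exact continuous_zero
  | add y z _ _ hy hz =>
    have : diag (y + z) = diag y + diag z := funext (diag_add y z)
    rw [this]; exact hy.add hz
  | smul c y _ hy =>
    have : diag (c • y) = fun x => c * diag y x := funext (diag_smul c y)
    rw [this]; exact continuous_const.mul hy

end PathRep

/-- The conditional expectation `E : O_Y → C(Y^ℕ)`, where `V_t V_t^*` is identified with the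
indicator function of `tY^ℕ`. It is the unique bounded linear map with `E(V_t V_u^*) = V_t V_t^*`
when `t = u` and `E(V_t V_u^*) = 0` otherwise, as shown in the two lemmas below. -/
def condExpect (Y : Type u) [Fintype Y] : CuntzAlgebra Y →L[ℂ] C(PathSpace Y, ℂ) :=
  LinearMap.mkContinuous
    { toFun := fun a => ⟨PathRep.diag a, PathRep.continuous_diag a⟩
      map_add' := fun a b => ContinuousMap.ext (PathRep.diag_add a b)
      map_smul' := fun c a => ContinuousMap.ext (PathRep.diag_smul c a) } 1
    (fun a => by
      rw [one_mul]
      exact (ContinuousMap.norm_le _ (norm_nonneg a)).2 (PathRep.norm_diag_le a))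

open scoped Classical in
theorem condExpect_word (t u : List Y) (x : PathSpace Y) :
    condExpect Y (wordProd CuntzAlgebra.gen t * star (wordProd CuntzAlgebra.gen u)) x =
      if t = u ∧ x ∈ PathSpace.cylinder t then 1 else 0 :=
  PathRep.diag_word t u x

theorem condExpect_unique (T : CuntzAlgebra Y →L[ℂ] C(PathSpace Y, ℂ))
    (h : ∀ t u, T (wordProd CuntzAlgebra.gen t * star (wordProd CuntzAlgebra.gen u)) =
      condExpect Y (wordProd CuntzAlgebra.gen t * star (wordProd CuntzAlgebra.gen u))) :
    T = condExpect Y := by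
  refine ContinuousLinearMap.ext fun a => ?_
  have ha : a ∈ (⊤ : StarSubalgebra ℂ (CuntzAlgebra Y)) := trivial
  rw [← CuntzAlgebra.closure_words_eq_top] at ha
  refine closure_minimal ?_ (isClosed_eq T.continuous (condExpect Y).continuous) ha
  intro b hb
  rw [SetLike.mem_coe, mem_wordSpan] at hb
  refine Submodule.span_induction (p := fun b _ => T b = condExpect Y b) ?_ ?_ ?_ ?_ hb
  · rintro _ ⟨t, u, _, rfl⟩
    exact h t u
  · simp
  · intro x y _ _ hx hy
    simp [hx, hy]
  · intro c x _ hx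
    simp [hx]

/-- A state: a positive linear functional with value `1` at the unit. Positive functionals on a
C*-algebra are bounded, so states are taken in the dual space, with its weak-* topology. -/
def IsState {A : Type*} [CStarAlgebra A] (ω : WeakDual ℂ A) : Prop :=
  (∀ a : A, 0 ≤ (ω (star a * a)).re ∧ (ω (star a * a)).im = 0) ∧ ω 1 = 1

/-- `f` is an entire function extending the orbit map `t ↦ α_t(a)` to the complex plane; it exists
exactly when `a` is an analytic element, and then `f z = α_z(a)`. -/
def IsEntireExtension {A : Type*} [CStarAlgebra A] (α : ℝ → A ≃⋆ₐ[ℂ] A) (a : A) (f : ℂ → A) :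
    Prop :=
  Differentiable ℂ f ∧ ∀ t : ℝ, f t = α t a

/-- `ω` is a `β`-KMS state for `α`: there is a dense `α`-invariant `*`-subalgebra `𝒜` of analytic
elements such that `ω(ab) = ω(b α_{iβ}(a))` for all `a, b ∈ 𝒜`. -/
def IsKMSState {A : Type*} [CStarAlgebra A] (α : ℝ → A ≃⋆ₐ[ℂ] A) (β : ℝ) (ω : WeakDual ℂ A) :
    Prop :=
  IsState ω ∧ ∃ 𝒜 : NonUnitalStarSubalgebra ℂ A, Dense (𝒜 : Set A) ∧
    (∀ t : ℝ, ∀ a ∈ 𝒜, α t a ∈ 𝒜) ∧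
    ∀ a ∈ 𝒜, ∃ f : ℂ → A, IsEntireExtension α a f ∧
      ∀ b ∈ 𝒜, ω (a * b) = ω (b * f (β * Complex.I))

section Cayley

variable {G : Type u} [Group G]

/-- The algebra `O_Y(G)` for a finite subset `Y` of the group `G`. -/
abbrev CayleyAlgebra (Y : Finset G) : Type (u + 1) := CayleyCuntz (fun s : Y => (s : G))

/-- The action `α^F` on `O_Y(G)`. -/
def cayleyAction (Y : Finset G) (F : Y → ℝ) (t : ℝ) : CayleyAlgebra Y ≃⋆ₐ[ℂ] CayleyAlgebra Y :=
  CayleyCuntz.gauge F t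

/-- The set of `β`-KMS states for `α^F` on `O_Y(G)`, with the weak-* topology. -/
def kmsStates (Y : Finset G) (F : Y → ℝ) (β : ℝ) : Set (WeakDual ℂ (CayleyAlgebra Y)) :=
  {ω | IsKMSState (cayleyAction Y F) β ω}

/-- `ω(a) = ∫ E(a) dm` for all `a ∈ O_Y(G)`. -/
def IsIntegralState (Y : Finset G) (m : MeasureTheory.ProbabilityMeasure (PathSpace Y))
    (ω : WeakDual ℂ (CayleyAlgebra Y)) : Prop :=
  ∀ a : CayleyAlgebra Y,
    ω a = ∫ x, condExpect Y (CayleyCuntz.incl a) x ∂(m : MeasureTheory.Measure (PathSpace Y))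

/-- The set of `β`-KMS measures: the Borel probability measures `m` on `Y^ℕ` for which the state
`a ↦ ∫ E(a) dm` is a `β`-KMS state. It carries the topology of weak convergence. -/
def kmsMeasures (Y : Finset G) (F : Y → ℝ) (β : ℝ) :
    Set (MeasureTheory.ProbabilityMeasure (PathSpace Y)) :=
  {m | ∃ ω ∈ kmsStates Y F β, IsIntegralState Y m ω}

/-- The set of normalized `β`-harmonic vectors, with the topology of pointwise convergence. -/
def normalizedHarmonicVectors (Y : Finset G) (F : Y → ℝ) (β : ℝ) : Set (G → ℝ) :=
  {ψ | (∀ g, 0 ≤ ψ g) ∧ (∀ g, ∑ s : Y, Real.exp (-β * F s) * ψ (g * s) = ψ g) ∧ ψ 1 = 1}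

/-- The convex combination `(1 - r) m₁ + r m₂` of probability measures, `r ∈ [0, 1]`. -/
def convexComb {X : Type*} [MeasurableSpace X] (r : unitInterval)
    (m₁ m₂ : MeasureTheory.ProbabilityMeasure X) : MeasureTheory.ProbabilityMeasure X :=
  ⟨ENNReal.ofReal (1 - r) • (m₁ : MeasureTheory.Measure X) +
      ENNReal.ofReal r • (m₂ : MeasureTheory.Measure X), ⟨by
    simp only [MeasureTheory.Measure.add_apply, MeasureTheory.Measure.smul_apply,
      MeasureTheory.measure_univ, smul_eq_mul, mul_one]
    rw [← ENNReal.ofReal_add (sub_nonneg.2 r.2.2) r.2.1]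
    simp⟩⟩

end Cayley
end

/-! Everything is read off from the numbers `ω(V_t V_t^*) = m(tY^ℕ)`.

For a KMS state `ω`, applying the KMS relation to `V_t V_u^*` and `V_u V_t^*` with `t̄ = ū` gives
`ω(V_t V_t^*) = e^{-β(F(t)-F(u))} ω(V_u V_u^*)` (`IsWordKMS.weight_eq`). So `e^{βF(t)} ω(V_t V_t^*)`
depends only on `t̄`; this is `ψ`. Harmonicity of `ψ` is additivity of the weights over one more
letter. Conversely, a harmonic vector gives consistent cylinder weights, hence a measure
(`PathSpace.exists_probabilityMeasure`), and the integral state of that measure satisfies the KMS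
relation on words by direct computation (`isWordKMS_integralState`).

Two points need an argument. The subalgebra `𝒜` in the definition of a KMS state depends on the
state and need not contain any `V_t V_u^*`. A contour integral over a long rectangle transfers the
relation from `𝒜` to all eigenvectors of the action (`IsKMSState.apply_mul_of_eigenvector`). After
that, being KMS is a family of linear conditions on the state (`isKMSState_gauge_iff`).

Secondly, a KMS state must vanish on `V_t V_u^*` for `t ≠ u` (`IsWordKMS.word_eq_zero`), so that it
is determined by its weights. The KMS relation reduces this to `u = tx` with `x` a nonempty loop, up
to adjoints. If the value were nonzero, `tx` would have the same weight as `t`. But a path can leave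
`t` by a letter other than the first letter of `x` and return to `t̄`, which puts a positive
multiple of the weight of `t` outside `tx`. Hence `t` has weight zero, and Cauchy–Schwarz makes the
value zero. This is where two letters and generation as a semigroup enter.

The topologies match because weak convergence on `Y^ℕ` is convergence on cylinders
(`PathSpace.isClosedEmbedding_measureReal_cylinder`). -/

section Proof

open scoped ENNReal

universe u

/-! ### Cylinders and Borel probability measures on the sequence space. -/

namespace PathSpace

open MeasureTheory Filter Topology

variable {S : Type*}

theorem cylinder_nil : cylinder ([] : List S) = Set.univ :=
  Set.eq_univ_of_forall fun _ => mem_cylinder_nil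

instance [Finite S] : TopologicalSpace.MetrizableSpace (PathSpace S) := by
  let _ : TopologicalSpace S := ⊥
  have : DiscreteTopology S := ⟨rfl⟩
  exact inferInstanceAs (TopologicalSpace.MetrizableSpace (ℕ → S))

theorem continuous_cons (s : S) : Continuous (cons s) := by
  let _ : TopologicalSpace S := ⊥
  refine @continuous_pi _ _ (fun _ : ℕ => S) _ _ _ fun n => ?_
  cases n with
  | zero => exact continuous_const
  | succ n => exact continuous_apply (A := fun _ : ℕ => S) n

/-- The word formed by the first `n` letters of a sequence. -/
def initial (x : PathSpace S) (n : ℕ) : List S := List.ofFn fun i : Fin n => x i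

theorem length_initial (x : PathSpace S) (n : ℕ) : (initial x n).length = n := by
  simp [initial]

theorem mem_cylinder_iff {t : List S} {x : PathSpace S} :
    x ∈ cylinder t ↔ initial x t.length = t := by
  constructor
  · intro h
    refine List.ext_get (length_initial _ _) fun n h1 h2 => ?_
    simpa [initial] using h ⟨n, h2⟩
  · intro h i
    have h3 : (initial x t.length)[i]? = t[i]? := by rw [h]
    simpa [initial] using h3

theorem mem_cylinder_initial (x : PathSpace S) (n : ℕ) : x ∈ cylinder (initial x n) := by
  rw [mem_cylinder_iff, length_initial]

theorem cylinder_inter {t u : List S} (h : t.length ≤ u.length)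
    (hne : (cylinder t ∩ cylinder u).Nonempty) : cylinder t ∩ cylinder u = cylinder u := by
  obtain ⟨y, hyt, hyu⟩ := hne
  refine Set.inter_eq_right.2 fun x hx i => ?_
  have h1 := hx ⟨i, i.2.trans_le h⟩
  have h2 := hyu ⟨i, i.2.trans_le h⟩
  exact h1.trans (h2.symm.trans (hyt i))

theorem isPiSystem_cylinder : IsPiSystem (Set.range (cylinder (S := S))) := by
  rintro _ ⟨t, rfl⟩ _ ⟨u, rfl⟩ hne
  rcases le_total t.length u.length with h | h
  · exact ⟨u, (cylinder_inter h hne).symm⟩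
  · rw [Set.inter_comm] at hne ⊢
    exact ⟨t, (cylinder_inter h hne).symm⟩

theorem isTopologicalBasis_cylinder :
    TopologicalSpace.IsTopologicalBasis (Set.range (cylinder (S := S))) := by
  refine TopologicalSpace.isTopologicalBasis_of_isOpen_of_nhds ?_ fun x U hx hU => ?_
  · rintro _ ⟨t, rfl⟩
    exact (isClopen_cylinder t).isOpen
  · let _ : TopologicalSpace S := ⊥
    obtain ⟨I, v, hv, hvU⟩ := (isOpen_pi_iff (A := fun _ : ℕ => S)).1 hU x hx
    obtain ⟨n, hn⟩ := I.bddAbove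
    refine ⟨_, ⟨initial x (n + 1), rfl⟩, mem_cylinder_initial _ _, fun y hy => hvU fun i hi => ?_⟩
    have h1 : y i = x i := by
      have := hy ⟨i, by rw [length_initial]; exact Nat.lt_succ_of_le (hn hi)⟩
      simpa only [List.get_eq_getElem, initial, List.getElem_ofFn] using this
    rw [h1]
    exact (hv i hi).2

theorem borel_eq_generateFrom_cylinder [Countable S] :
    (inferInstance : MeasurableSpace (PathSpace S)) =
      MeasurableSpace.generateFrom (Set.range cylinder) := by
  have : SecondCountableTopology (PathSpace S) :=
    isTopologicalBasis_cylinder.secondCountableTopology (Set.countable_range _)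
  exact isTopologicalBasis_cylinder.borel_eq_generateFrom

theorem measurableSet_cylinder (t : List S) : MeasurableSet (cylinder t) :=
  (isClopen_cylinder t).isOpen.measurableSet

theorem probabilityMeasure_ext [Countable S] {m₁ m₂ : ProbabilityMeasure (PathSpace S)}
    (h : ∀ t : List S, m₁.toMeasure.real (cylinder t) = m₂.toMeasure.real (cylinder t)) :
    m₁ = m₂ := by
  refine Subtype.ext ?_
  change m₁.toMeasure = m₂.toMeasure
  refine ext_of_generate_finite _ borel_eq_generateFrom_cylinder isPiSystem_cylinder ?_ (by simp)
  rintro _ ⟨t, rfl⟩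
  exact (measureReal_eq_measureReal_iff (μ := m₁.toMeasure) (ν := m₂.toMeasure)).1 (h t)

theorem continuous_measureReal_cylinder [Finite S] (t : List S) :
    Continuous fun m : ProbabilityMeasure (PathSpace S) => m.toMeasure.real (cylinder t) := by
  refine continuous_iff_continuousAt.2 fun m => ?_
  have h := ProbabilityMeasure.tendsto_measure_of_isClopen_of_tendsto
    (tendsto_id (α := ProbabilityMeasure (PathSpace S)) (x := 𝓝 m)) (isClopen_cylinder t)
  exact (NNReal.continuous_coe.tendsto _).comp h

/-- Weak convergence of probability measures on `Y^ℕ` is convergence on cylinders. -/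
theorem isClosedEmbedding_measureReal_cylinder [Finite S] :
    IsClosedEmbedding fun (m : ProbabilityMeasure (PathSpace S)) (t : List S) =>
      m.toMeasure.real (cylinder t) :=
  -- The source is compact and the target Hausdorff, so a continuous injection suffices; injectivity
  -- holds because cylinders form a π-system generating the Borel sets.
  (continuous_pi continuous_measureReal_cylinder).isClosedEmbedding
    fun _ _ h => probabilityMeasure_ext fun t => congrFun h t

theorem preimage_cons_cylinder_cons [DecidableEq S] (a s : S) (t : List S) :
    cons a ⁻¹' cylinder (s :: t) = if a = s then cylinder t else ∅ := by
  ext x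
  rw [Set.mem_preimage, mem_cylinder_cons]
  change a = s ∧ x ∈ cylinder t ↔ _
  split_ifs with h <;> simp [h]

/-- Push measures for the weights `q (a :: ·)` forward along `x ↦ ax` and add over `a`; the
induction therefore needs all `q` at once. Only lengths up to `n` are matched, so the recursion may
start from a point mass at any sequence. -/
theorem exists_measure_of_length_le [Fintype S] [Nonempty S] (n : ℕ) :
    ∀ q : List S → ℝ≥0∞, (∀ t, ∑ s, q (t ++ [s]) = q t) →
      ∃ m : Measure (PathSpace S), ∀ t : List S, t.length ≤ n → m (cylinder t) = q t := by
  classical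
  induction n with
  | zero =>
    intro q _
    obtain ⟨x⟩ : Nonempty (PathSpace S) := ⟨fun _ => Classical.arbitrary S⟩
    refine ⟨q [] • Measure.dirac x, fun t ht => ?_⟩
    obtain rfl : t = [] := List.length_eq_zero_iff.1 (by omega)
    simp [cylinder_nil]
  | succ n ih =>
    intro q hq
    choose m hm using fun a : S => ih (fun t => q (a :: t)) fun t => hq (a :: t)
    refine ⟨∑ a, (m a).map (cons a), fun t ht => ?_⟩
    have hmap (a : S) : (m a).map (cons a) (cylinder t) = m a (cons a ⁻¹' cylinder t) :=
      Measure.map_apply (continuous_cons a).measurable (measurableSet_cylinder t)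
    rw [Measure.finsetSum_apply]
    simp only [hmap]
    cases t with
    | nil =>
      rw [← hq []]
      refine Finset.sum_congr rfl fun a _ => ?_
      rw [cylinder_nil, Set.preimage_univ, ← cylinder_nil, hm a [] (by simp)]
      rfl
    | cons s t =>
      simp only [preimage_cons_cylinder_cons]
      rw [Finset.sum_eq_single s (fun a _ ha => by simp [ha]) (by simp)]
      simpa using hm s t (by simpa using ht)

/-- A consistent family of cylinder weights comes from a Borel probability measure. -/
theorem exists_probabilityMeasure [Fintype S] (p : List S → ℝ) (h0 : ∀ t, 0 ≤ p t)
    (h1 : p [] = 1) (hp : ∀ t, ∑ s, p (t ++ [s]) = p t) :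
    ∃ m : ProbabilityMeasure (PathSpace S), ∀ t, m.toMeasure.real (cylinder t) = p t := by
  have : Nonempty S := by
    by_contra h
    rw [not_nonempty_iff] at h
    have := hp []
    simp [h1] at this
  choose m hm using fun n => exists_measure_of_length_le n (fun t => ENNReal.ofReal (p t))
    fun t => by rw [← ENNReal.ofReal_sum_of_nonneg fun _ _ => h0 _, hp]
  have hprob (n : ℕ) : IsProbabilityMeasure (m n) :=
    ⟨by rw [← cylinder_nil, hm n [] (by simp), h1, ENNReal.ofReal_one]⟩
  let mp (n : ℕ) : ProbabilityMeasure (PathSpace S) := ⟨m n, hprob n⟩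
  -- On each cylinder the approximating measures are eventually constant, so their weights converge
  -- to `p`; the set of realizable weights is closed by compactness, which gives a measure with
  -- weights exactly `p`.
  have hlim : Tendsto (fun n (t : List S) =>
      (mp n).toMeasure.real (cylinder t)) atTop (𝓝 p) := by
    refine tendsto_pi_nhds.2 fun t => tendsto_atTop_of_eventually_const (i₀ := t.length)
      fun n hn => ?_
    change ((m n) (cylinder t)).toReal = p t
    rw [hm n t hn, ENNReal.toReal_ofReal (h0 t)]
  obtain ⟨m', hm'⟩ := isClosedEmbedding_measureReal_cylinder.isClosed_range.mem_of_tendsto hlim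
    (Eventually.of_forall fun n => ⟨_, rfl⟩)
  exact ⟨m', fun t => congrFun hm' t⟩

end PathSpace

/-! ### The KMS relation for eigenvectors of a one-parameter group. -/

section KMS

open Complex

variable {A : Type*} [CStarAlgebra A]

theorem weakDual_norm_apply_le (ω : WeakDual ℂ A) :
    ∃ C : ℝ, 0 ≤ C ∧ ∀ a : A, ‖ω a‖ ≤ C * ‖a‖ :=
  ⟨‖WeakDual.toStrongDual ω‖, norm_nonneg _, (WeakDual.toStrongDual ω).le_opNorm⟩

theorem norm_starAlgEquiv (f : A ≃⋆ₐ[ℂ] A) (a : A) : ‖f a‖ = ‖a‖ :=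
  NonUnitalStarAlgHom.norm_map f (EquivLike.injective f) a

theorem entire_eq_of_eq_ofReal {f g : ℂ → A} (hf : Differentiable ℂ f) (hg : Differentiable ℂ g)
    (h : ∀ t : ℝ, f t = g t) : f = g := by
  refine AnalyticOnNhd.eq_of_frequently_eq (z₀ := 0) (𝕜 := ℂ)
    (fun z _ => hf.analyticAt z) (fun z _ => hg.analyticAt z) ?_
  have h1 : Filter.Tendsto (fun n : ℕ => (((1 / ((n : ℝ) + 1) : ℝ)) : ℂ)) Filter.atTop
      (nhdsWithin 0 {0}ᶜ) := by
    refine tendsto_nhdsWithin_iff.2 ⟨?_, Filter.Eventually.of_forall fun n => ?_⟩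
    · have := (Complex.continuous_ofReal.tendsto 0).comp
        (tendsto_one_div_add_atTop_nhds_zero_nat (𝕜 := ℝ))
      simpa [Function.comp_def] using this
    · simp only [Set.mem_compl_iff, Set.mem_singleton_iff, ofReal_eq_zero]
      positivity
  exact h1.frequently (Filter.Eventually.of_forall fun n => h _).frequently

/-- Both sides are entire in `z` and agree on the real line. As `α t` is isometric, this makes the
norm of the extension constant along horizontal lines. -/
theorem IsEntireExtension.map_add {α : ℝ → A ≃⋆ₐ[ℂ] A}
    (hα : ∀ s t a, α (s + t) a = α s (α t a)) {a : A} {f : ℂ → A} (hf : IsEntireExtension α a f)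
    (t : ℝ) (z : ℂ) : f (t + z) = α t (f z) := by
  have hc : Continuous (α t) := continuous_starAlgHom (α t : A →⋆ₐ[ℂ] A)
  let L : A →L[ℂ] A := ⟨(α t : A →⋆ₐ[ℂ] A).toAlgHom.toLinearMap, hc⟩
  have h : (fun z : ℂ => f (t + z)) = fun z => L (f z) := by
    refine entire_eq_of_eq_ofReal (hf.1.comp (differentiable_id.const_add _))
      (L.differentiable.comp hf.1) fun s => ?_
    change f (t + s) = α t (f s)
    rw [← ofReal_add, hf.2, hf.2, hα]
  exact congrFun h z

theorem IsEntireExtension.unique {α : ℝ → A ≃⋆ₐ[ℂ] A} {a : A} {f g : ℂ → A}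
    (hf : IsEntireExtension α a f) (hg : IsEntireExtension α a g) : f = g :=
  entire_eq_of_eq_ofReal hf.1 hg.1 fun t => (hf.2 t).trans (hg.2 t).symm

/-- If an entire function is bounded on the strip between `ℝ` and `ℝ + iβ` and is close to a
constant on each of the two boundary lines, then the two constants are close. -/
theorem norm_sub_le_of_boundary_strip {g : ℂ → ℂ} (hg : Differentiable ℂ g) {β M ε₁ ε₂ : ℝ}
    {c₁ c₂ : ℂ} (hM : ∀ t : ℝ, ∀ s ∈ Set.uIcc 0 β, ‖g (t + s * I)‖ ≤ M)
    (h₁ : ∀ t : ℝ, ‖g t - c₁‖ ≤ ε₁) (h₂ : ∀ t : ℝ, ‖g (t + β * I) - c₂‖ ≤ ε₂) :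
    ‖c₁ - c₂‖ ≤ ε₁ + ε₂ := by
  -- Cauchy's theorem on the rectangle with corners `0` and `T + iβ`: the horizontal sides
  -- contribute about `T c₁` and `T c₂`, the vertical ones at most `M |β|` each, which is negligible
  -- after division by `T`.
  have key (T : ℝ) (hT : 0 < T) : ‖c₁ - c₂‖ ≤ (ε₁ + ε₂) + (2 * (M * |β|)) / T := by
    have hrect := integral_boundary_rect_eq_zero_of_differentiableOn g 0 (T + β * I)
      hg.differentiableOn
    have hcont : Continuous g := hg.continuous
    simp only [zero_re, add_re, ofReal_re, mul_re, I_re, mul_zero, ofReal_im, I_im, mul_one,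
      sub_self, add_zero, zero_im, ofReal_zero, zero_mul, add_im, mul_im, zero_add,
      smul_eq_mul] at hrect
    have hv (t : ℝ) : ‖∫ y : ℝ in (0 : ℝ)..β, g (t + y * I)‖ ≤ M * |β| := by
      have := intervalIntegral.norm_integral_le_of_norm_le_const (a := 0) (b := β)
        (f := fun y : ℝ => g (t + y * I)) (C := M)
        fun y hy => hM t y (Set.uIoc_subset_uIcc hy)
      simpa using this
    have hh₁ : ‖(∫ x : ℝ in (0 : ℝ)..T, (g x - c₁))‖ ≤ ε₁ * T := by
      have := intervalIntegral.norm_integral_le_of_norm_le_const (a := 0) (b := T)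
        (f := fun x : ℝ => g x - c₁) (C := ε₁) fun y _ => h₁ y
      simpa [abs_of_pos hT] using this
    have hh₂ : ‖(∫ x : ℝ in (0 : ℝ)..T, (g (x + β * I) - c₂))‖ ≤ ε₂ * T := by
      have := intervalIntegral.norm_integral_le_of_norm_le_const (a := 0) (b := T)
        (f := fun x : ℝ => g (x + β * I) - c₂) (C := ε₂) fun y _ => h₂ y
      simpa [abs_of_pos hT] using this
    rw [intervalIntegral.integral_sub (Continuous.intervalIntegrable (by fun_prop) _ _)
      (Continuous.intervalIntegrable (by fun_prop) _ _), intervalIntegral.integral_const] at hh₁ hh₂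
    set J₁ := ∫ x : ℝ in (0 : ℝ)..T, g x
    set J₂ := ∫ x : ℝ in (0 : ℝ)..T, g (x + β * I)
    have hv₀ := hv 0
    have hvT := hv T
    simp only [ofReal_zero, zero_add] at hv₀
    set K₀ := ∫ y : ℝ in (0 : ℝ)..β, g (y * I)
    set K₁ := ∫ y : ℝ in (0 : ℝ)..β, g (T + y * I)
    have hid : (T : ℂ) * (c₁ - c₂) =
        -(J₁ - (T - 0) • c₁) + (J₂ - (T - 0) • c₂) - I * K₁ + I * K₀ := by
      simp only [sub_zero, real_smul]
      linear_combination hrect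
    have hn : T * ‖c₁ - c₂‖ ≤ ε₁ * T + ε₂ * T + M * |β| + M * |β| := by
      have : T * ‖c₁ - c₂‖ = ‖(T : ℂ) * (c₁ - c₂)‖ := by
        rw [norm_mul, norm_real, Real.norm_of_nonneg hT.le]
      rw [this, hid]
      refine (norm_add_le _ _).trans (add_le_add ((norm_sub_le _ _).trans
        (add_le_add ((norm_add_le _ _).trans (add_le_add ?_ hh₂)) ?_)) ?_)
      · rwa [norm_neg]
      · simpa using hvT
      · simpa using hv₀
    rw [← sub_le_iff_le_add', le_div_iff₀ hT]
    linarith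
  have hlim : Filter.Tendsto (fun T : ℝ => (ε₁ + ε₂) + (2 * (M * |β|)) / T) Filter.atTop
      (nhds ((ε₁ + ε₂) + 0)) :=
    tendsto_const_nhds.add (tendsto_const_nhds.div_atTop Filter.tendsto_id)
  rw [add_zero] at hlim
  exact ge_of_tendsto hlim ((Filter.eventually_gt_atTop 0).mono key)

/-- The KMS condition holds for eigenvectors of the action, even if these do not belong to the
subalgebra of analytic elements in the definition. -/
theorem IsKMSState.apply_mul_of_eigenvector {α : ℝ → A ≃⋆ₐ[ℂ] A}
    (hα : ∀ s t a, α (s + t) a = α s (α t a)) {β : ℝ} {ω : WeakDual ℂ A}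
    (h : IsKMSState α β ω) {a : A} {c : ℝ} (ha : ∀ t : ℝ, α t a = exp (I * t * c) • a) (b : A) :
    ω (a * b) = Real.exp (-β * c) * ω (b * a) := by
  obtain ⟨-, 𝒜, hdense, hinv, hkms⟩ := h
  obtain ⟨C, hC0, hC⟩ := weakDual_norm_apply_le ω
  have hω : Continuous ω := ω.2
  -- The relation is closed in `b`, so density allows `b ∈ 𝒜`. The fixed eigenvector `a` can only be
  -- approximated by elements of `𝒜` that need not be eigenvectors.
  suffices H : ∀ b ∈ 𝒜, ω (b * a) = Real.exp (β * c) * ω (a * b) by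
    have H' : ∀ b : A, ω (b * a) = Real.exp (β * c) * ω (a * b) := fun b => by
      refine hdense.induction (P := fun b => ω (b * a) = Real.exp (β * c) * ω (a * b))
        (fun b hb => H b hb) (isClosed_eq ?_ ?_) b
      · exact hω.comp (continuous_mul_const a)
      · exact continuous_const.mul (hω.comp (continuous_const_mul a))
    rw [H', ← mul_assoc, ← ofReal_mul, ← Real.exp_add]
    simp
  intro b hb
  have hphase (t : ℝ) (z : ℂ) : ‖exp (-I * c * t) * z‖ = ‖z‖ := by
    rw [norm_mul, show -I * c * t = ((-c * t : ℝ) : ℂ) * I by push_cast; ring,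
      norm_exp_ofReal_mul_I, one_mul]
  have hphase' (t : ℝ) : exp (-I * c * t) * exp (I * t * c) = 1 := by
    rw [← exp_add, show -I * c * t + I * t * c = 0 by ring, exp_zero]
  have key (a' : A) (ha' : a' ∈ 𝒜) : ‖ω (b * a) - Real.exp (β * c) * ω (a * b)‖ ≤
      C * (‖b‖ * ‖a' - a‖) + Real.exp (β * c) * (C * (‖b‖ * ‖a' - a‖)) := by
    obtain ⟨f, hf, hfb⟩ := hkms a' ha'
    have hdiff (t : ℝ) : ‖α t a' - exp (I * t * c) • a‖ = ‖a' - a‖ := by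
      rw [← ha, ← map_sub, norm_starAlgEquiv]
    -- Since `f (t + is) = α t (f (is))`, a bound that depends on `s` alone holds on the whole
    -- strip.
    obtain ⟨M, hM⟩ := (isCompact_uIcc (a := (0 : ℝ)) (b := β)).exists_bound_of_continuousOn
      (f := fun s : ℝ => exp (c * s) * (C * (‖b‖ * ‖f (s * I)‖) : ℝ)) (by
        have := hf.1.continuous
        fun_prop)
    have hωf : Differentiable ℂ fun z => ω (b * f z) :=
      (WeakDual.toStrongDual ω).differentiable.comp ((differentiable_const b).mul hf.1)
    -- The factor `e^{-icz}` cancels the phase of `α t a`. If `a'` were equal to `a`, the function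
    -- would be constantly `ω(ba)` on the real line and `e^{βc} ω(ab)` on the line `ℝ + iβ`.
    refine norm_sub_le_of_boundary_strip (g := fun z => exp (-I * c * z) * ω (b * f z))
      (Differentiable.mul (by fun_prop) hωf) (M := M) ?_ (fun t => ?_) (fun t => ?_) (β := β)
    · intro t s hs
      refine le_trans ?_ (hM s hs)
      rw [hf.map_add hα, mul_add, exp_add, mul_assoc, hphase]
      rw [show -I * c * (s * I) = ((c * s : ℝ) : ℂ) by
        push_cast; linear_combination (-(c : ℂ) * s) * I_mul_I]
      rw [norm_mul, norm_mul, ofReal_mul c s, norm_real,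
        Real.norm_of_nonneg (by positivity)]
      gcongr
      refine (hC _).trans ?_
      gcongr
      refine (norm_mul_le _ _).trans ?_
      rw [norm_starAlgEquiv]
    · have h1 : exp (-I * c * t) * ω (b * f t) - ω (b * a) =
          exp (-I * c * t) * ω (b * (α t a' - exp (I * t * c) • a)) := by
        rw [hf.2, mul_sub, map_sub, mul_sub, mul_smul_comm, map_smul, smul_eq_mul, ← mul_assoc,
          hphase', one_mul]
      rw [h1, hphase]
      refine (hC _).trans ?_
      gcongr
      refine (norm_mul_le _ _).trans ?_
      rw [hdiff]
    -- On the upper line the KMS condition is used for `α t a'`, whose entire extension is the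
    -- translate `f (t + ·)`.
    · obtain ⟨f', hf', hfb'⟩ := hkms (α t a') (hinv t a' ha')
      have h2 : f' (β * I) = f (t + β * I) := by
        have : f' = fun z => f (t + z) := by
          refine hf'.unique ⟨hf.1.comp (differentiable_id.const_add _), fun s => ?_⟩
          change f (t + s) = _
          rw [← ofReal_add, hf.2, add_comm, hα]
        rw [this]
      have h1 : exp (-I * c * (t + β * I)) * ω (b * f (t + β * I)) -
            Real.exp (β * c) * ω (a * b) =
          Real.exp (β * c) *
            (exp (-I * c * t) * ω ((α t a' - exp (I * t * c) • a) * b)) := by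
        rw [← h2, ← hfb' b hb, sub_mul, map_sub, mul_sub, smul_mul_assoc, map_smul, smul_eq_mul,
          ← mul_assoc (exp (-I * c * t)) (exp _), hphase', one_mul, mul_add, exp_add,
          show -I * c * (β * I) = ((β * c : ℝ) : ℂ) by
            push_cast; linear_combination (-(c : ℂ) * β) * I_mul_I, ofReal_exp]
        ring
      rw [h1, norm_mul, norm_real, Real.norm_of_nonneg (Real.exp_pos _).le, hphase]
      gcongr
      refine (hC _).trans ?_
      gcongr
      refine (norm_mul_le _ _).trans ?_
      rw [hdiff, mul_comm]
  have h0 : ‖ω (b * a) - Real.exp (β * c) * ω (a * b)‖ ≤ 0 := by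
    -- The estimate no longer involves the extension of `a'`, so it passes to the closure of `𝒜`,
    -- where `a' = a` is allowed and makes the bound zero.
    have : ∀ a' : A, ‖ω (b * a) - Real.exp (β * c) * ω (a * b)‖ ≤
        C * (‖b‖ * ‖a' - a‖) + Real.exp (β * c) * (C * (‖b‖ * ‖a' - a‖)) := fun a' =>
      hdense.induction (P := fun a' => ‖ω (b * a) - Real.exp (β * c) * ω (a * b)‖ ≤
        C * (‖b‖ * ‖a' - a‖) + Real.exp (β * c) * (C * (‖b‖ * ‖a' - a‖)))
        (fun a' ha' => key a' ha')
        (isClosed_le continuous_const (by fun_prop)) a'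
    simpa using this a
  exact sub_eq_zero.1 (norm_le_zero_iff.1 h0)

end KMS

/-! ### Consequences of positivity. -/

section States

variable {A : Type*} [CStarAlgebra A] {ω : WeakDual ℂ A}

/-- Polarization: `ω((1 + a)^*(1 + a))` is real, and so is the same expression with `ia` in place of
`a`. -/
theorem IsState.map_star (h : IsState ω) (a : A) : ω (star a) = star (ω a) := by
  have key (a : A) : (ω (star a)).im + (ω a).im = 0 := by
    have := (h.1 (1 + a)).2
    simpa only [star_add, star_one, add_mul, mul_add, one_mul, mul_one, map_add, Complex.add_im,
      h.2, Complex.one_im, (h.1 a).2, add_zero, zero_add] using this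
  have h1 := key a
  have h2 := key (Complex.I • a)
  simp only [star_smul, map_smul, smul_eq_mul, Complex.star_def, Complex.conj_I, neg_mul,
    Complex.neg_im, Complex.I_mul_im] at h2
  apply Complex.ext
  · simp only [Complex.star_def, Complex.conj_re]; linarith
  · simp only [Complex.star_def, Complex.conj_im]; linarith

/-- A case of Cauchy–Schwarz. As `ω(p) = 0`, the nonnegative number `ω((sp + a)^*(sp + a))` is
affine in the real parameter `s`, so its slope `2 Re ω(pa)` vanishes. -/
theorem IsState.apply_proj_mul_eq_zero (h : IsState ω) {p : A} (hp : star p = p) (hpp : p * p = p)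
    (h0 : ω p = 0) (a : A) : ω (p * a) = 0 := by
  have hre (a : A) : (ω (p * a)).re = 0 := by
    have hst : ω (star a * p) = star (ω (p * a)) := by
      rw [← h.map_star, star_mul, hp]
    have key (s : ℝ) : 0 ≤ s * (2 * (ω (p * a)).re) + (ω (star a * a)).re := by
      have := (h.1 ((s : ℂ) • p + a)).1
      simp only [star_add, star_smul, hp, add_mul, mul_add, smul_mul_assoc, mul_smul_comm, hpp,
        map_add, map_smul, h0, hst, smul_eq_mul, Complex.star_def, Complex.conj_ofReal,
        Complex.add_re, Complex.re_ofReal_mul, Complex.conj_re, mul_zero, Complex.zero_re] at this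
      linarith
    by_contra hne
    -- This `s` makes the affine expression equal to `-1`.
    have := key (-((ω (star a * a)).re + 1) / (2 * (ω (p * a)).re))
    rw [div_mul_cancel₀ _ (by simpa using hne)] at this
    linarith
  have h2 := hre (Complex.I • a)
  rw [mul_smul_comm, map_smul, smul_eq_mul, Complex.I_mul_re, neg_eq_zero] at h2
  exact Complex.ext (hre a) h2

theorem IsState.convex_comb {ω₁ ω₂ : WeakDual ℂ A} (h₁ : IsState ω₁) (h₂ : IsState ω₂) {a b : ℝ}
    (ha : 0 ≤ a) (hb : 0 ≤ b) (hab : a + b = 1) : IsState (a • ω₁ + b • ω₂) := by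
  have happ (x : A) : (a • ω₁ + b • ω₂) x = a * ω₁ x + b * ω₂ x := rfl
  refine ⟨fun x => ?_, ?_⟩
  · rw [happ]
    simp only [Complex.add_re, Complex.re_ofReal_mul, Complex.add_im, Complex.im_ofReal_mul,
      (h₁.1 x).2, (h₂.1 x).2, mul_zero, add_zero, and_true]
    have := mul_nonneg ha (h₁.1 x).1
    have := mul_nonneg hb (h₂.1 x).1
    linarith
  · rw [happ, h₁.2, h₂.2, mul_one, mul_one, ← Complex.ofReal_add, hab, Complex.ofReal_one]

end States

/-! ### The elements `V_t V_u^*` of `O_Y(G)` and the KMS relation on them. -/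

section WordProducts

variable {A : Type*} [CStarAlgebra A] {S : Type*} {V : S → A}

theorem star_wordProd_mul_self (h1 : ∀ s, star (V s) * V s = 1) (t : List S) :
    star (wordProd V t) * wordProd V t = 1 := by
  induction t with
  | nil => simp
  | cons s t ih =>
    rw [wordProd_cons, star_mul, mul_assoc, ← mul_assoc (star (V s)), h1, one_mul, ih]

theorem star_wordProd_mul_append (h1 : ∀ s, star (V s) * V s = 1) (t x : List S) :
    star (wordProd V t) * wordProd V (t ++ x) = wordProd V x := by
  rw [wordProd_append, ← mul_assoc, star_wordProd_mul_self h1, one_mul]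

theorem star_wordProd_append_mul (h1 : ∀ s, star (V s) * V s = 1) (t x : List S) :
    star (wordProd V (t ++ x)) * wordProd V t = star (wordProd V x) := by
  rw [← star_wordProd_mul_append h1 t x, star_mul, star_star]

end WordProducts

namespace CayleyCuntz

open CuntzAlgebra

section EvalWord

variable {Y : Type*} {H : Type*} [Group H] {ev : Y → H}

/-- The value of a word in the group. -/
def evalWord (ev : Y → H) (t : List Y) : H := (t.map ev).prod

@[simp] theorem evalWord_nil : evalWord ev [] = 1 := rfl

@[simp] theorem evalWord_append (t u : List Y) :
    evalWord ev (t ++ u) = evalWord ev t * evalWord ev u := by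
  simp [evalWord]

@[simp] theorem evalWord_singleton (s : Y) : evalWord ev [s] = ev s := by
  simp [evalWord]

end EvalWord

variable {Y : Type u} [Fintype Y] {H : Type*} [Group H] {ev : Y → H}

theorem incl_injective : Function.Injective (incl (ev := ev)) := Subtype.val_injective

/-- The element `V_t V_u^*` of `O_Y(G)`, for words `t` and `u` with the same value. -/
noncomputable def word (t u : List Y) (h : evalWord ev t = evalWord ev u) : CayleyCuntz ev :=
  ⟨wordProd gen t * star (wordProd gen u),
    StarSubalgebra.le_topologicalClosure _ (Submodule.subset_span ⟨t, u, h, rfl⟩)⟩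

theorem incl_word (t u : List Y) (h : evalWord ev t = evalWord ev u) :
    incl (word t u h) = wordProd gen t * star (wordProd gen u) := rfl

theorem word_nil : word (ev := ev) [] [] rfl = 1 :=
  incl_injective (by rw [incl_word, map_one]; simp)

theorem star_word (t u : List Y) (h : evalWord ev t = evalWord ev u) :
    star (word t u h) = word u t h.symm :=
  incl_injective (by rw [starAlgHom_star, incl_word, incl_word, star_mul, star_star])

theorem incl_word_mul (t u w z : List Y) (h : evalWord ev t = evalWord ev u)
    (h' : evalWord ev w = evalWord ev z) : incl (word t u h * word w z h') =
      wordProd gen t * (star (wordProd gen u) * wordProd gen w) * star (wordProd gen z) := by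
  rw [map_mul, incl_word, incl_word]
  simp only [mul_assoc]

/-- With `word_append_mul` and `word_mul_eq_zero_or` this is the whole multiplication table: a
product vanishes unless one of the inner words extends the other, and then the common prefix
cancels. -/
theorem word_mul_append (t u x z : List Y) (h : evalWord ev t = evalWord ev u)
    (h' : evalWord ev (u ++ x) = evalWord ev z) :
    word t u h * word (u ++ x) z h' = word (t ++ x) z (by rw [← h']; simp [h]) :=
  incl_injective (by
    rw [incl_word_mul, star_wordProd_mul_append star_gen_mul_gen, incl_word, wordProd_append])

theorem word_append_mul (t w x z : List Y) (h : evalWord ev t = evalWord ev (w ++ x))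
    (h' : evalWord ev w = evalWord ev z) :
    word t (w ++ x) h * word w z h' = word t (z ++ x) (by rw [h]; simp [h']) :=
  incl_injective (by
    rw [incl_word_mul, star_wordProd_append_mul star_gen_mul_gen, incl_word, wordProd_append,
      star_mul, mul_assoc])

theorem word_mul (t u z : List Y) (h : evalWord ev t = evalWord ev u)
    (h' : evalWord ev u = evalWord ev z) :
    word t u h * word u z h' = word t z (h.trans h') := by
  simpa using word_mul_append t u [] z h (by simpa using h')

theorem word_mul_eq_zero_or (t u w z : List Y) (h : evalWord ev t = evalWord ev u)
    (h' : evalWord ev w = evalWord ev z) :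
    word t u h * word w z h' = 0 ∨ (∃ x, w = u ++ x) ∨ ∃ x, u = w ++ x := by
  rcases star_wordProd_mul star_gen_mul_gen star_gen_mul_gen_of_ne u w with h0 | ⟨x, hx, -⟩ |
    ⟨x, hx, -⟩
  · left
    refine incl_injective ?_
    rw [incl_word_mul, h0, mul_zero, zero_mul, map_zero]
  · exact Or.inr (Or.inl ⟨x, hx⟩)
  · exact Or.inr (Or.inr ⟨x, hx⟩)

/-- The projection `V_t V_t^*` in `O_Y(G)`. -/
noncomputable def rangeProj (ev : Y → H) (t : List Y) : CayleyCuntz ev := word t t rfl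

theorem star_rangeProj (t : List Y) : star (rangeProj ev t) = rangeProj ev t := star_word _ _ _

theorem rangeProj_mul_self (t : List Y) : rangeProj ev t * rangeProj ev t = rangeProj ev t :=
  word_mul _ _ _ _ _

theorem rangeProj_mul_word (t u : List Y) (h : evalWord ev t = evalWord ev u) :
    rangeProj ev t * word t u h = word t u h := word_mul _ _ _ _ _

theorem sum_rangeProj (t : List Y) : ∑ s, rangeProj ev (t ++ [s]) = rangeProj ev t := by
  refine incl_injective ?_
  rw [map_sum]
  simp only [rangeProj, incl_word]
  calc _ = ∑ s : Y, wordProd gen t * (gen s * star (gen s)) * star (wordProd gen t) := by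
        refine Finset.sum_congr rfl fun s _ => ?_
        simp [wordProd_append, mul_assoc]
    _ = _ := by rw [← Finset.sum_mul, ← Finset.mul_sum, sum_gen_mul_star_gen, mul_one]

theorem gauge_add (F : Y → ℝ) (r t : ℝ) (a : CayleyCuntz ev) :
    gauge F (r + t) a = gauge F r (gauge F t a) :=
  incl_injective (CuntzAlgebra.gauge_add F r t (incl a))

theorem gauge_word (F : Y → ℝ) (r : ℝ) (t u : List Y) (h : evalWord ev t = evalWord ev u) :
    gauge F r (word t u h) =
      Complex.exp (Complex.I * r * ((t.map F).sum - (u.map F).sum : ℝ)) • word t u h :=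
  incl_injective (by
    rw [incl_gauge, map_smul, incl_word]
    exact CuntzAlgebra.gauge_word F r t u)

/-- The linear span of the elements `V_t V_u^*` in `O_Y(G)`. -/
noncomputable def wordSubalgebra (ev : Y → H) : StarSubalgebra ℂ (CayleyCuntz ev) :=
  (wordSpan gen star_gen_mul_gen star_gen_mul_gen_of_ne ev).comap incl

/-- The set of the elements `V_t V_u^*` of `O_Y(G)`. -/
def words (ev : Y → H) : Set (CayleyCuntz ev) := {a | ∃ t u h, a = word t u h}

theorem mem_wordSubalgebra {a : CayleyCuntz ev} :
    a ∈ wordSubalgebra ev ↔ a ∈ Submodule.span ℂ (words ev) := by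
  have himage : (incl (ev := ev)).toAlgHom.toLinearMap '' words ev = wordSet gen ev := by
    ext b
    constructor
    · rintro ⟨_, ⟨t, u, h, rfl⟩, rfl⟩
      exact ⟨t, u, h, rfl⟩
    · rintro ⟨t, u, h, rfl⟩
      exact ⟨_, ⟨t, u, h, rfl⟩, rfl⟩
  change incl a ∈ Submodule.span ℂ (wordSet gen ev) ↔ _
  rw [← himage, Submodule.span_image]
  constructor
  · rintro ⟨b, hb, hba⟩
    exact incl_injective hba ▸ hb
  · exact fun h => ⟨a, h, rfl⟩

theorem dense_wordSubalgebra : Dense (wordSubalgebra ev : Set (CayleyCuntz ev)) := by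
  have hind : Topology.IsInducing (incl (ev := ev)) :=
    (Topology.IsInducing.subtypeVal : Topology.IsInducing
      (Subtype.val : groupSubalgebra ev → CuntzAlgebra Y))
  intro a
  rw [hind.closure_eq_preimage_closure_image, Set.mem_preimage]
  refine closure_mono ?_ a.2
  intro b hb
  exact ⟨⟨b, StarSubalgebra.le_topologicalClosure _ hb⟩, hb, rfl⟩

/-- A property of elements of `O_Y(G)` that is closed, linear and true for all `V_t V_u^*` holds
everywhere. -/
theorem induction_word {p : CayleyCuntz ev → Prop} (hcl : IsClosed {a | p a}) (h0 : p 0)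
    (hadd : ∀ a b, p a → p b → p (a + b)) (hsmul : ∀ (c : ℂ) a, p a → p (c • a))
    (hword : ∀ t u h, p (word t u h)) (a : CayleyCuntz ev) : p a := by
  refine dense_wordSubalgebra.induction (P := p) (fun b hb => ?_) hcl a
  refine Submodule.span_induction (p := fun b _ => p b) ?_ h0 (fun x y _ _ => hadd x y)
    (fun c x _ => hsmul c x) (mem_wordSubalgebra.1 hb)
  rintro _ ⟨t, u, h, rfl⟩
  exact hword t u h

theorem weakDual_ext {ω₁ ω₂ : WeakDual ℂ (CayleyCuntz ev)}
    (h : ∀ t u h, ω₁ (word t u h) = ω₂ (word t u h)) : ω₁ = ω₂ := by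
  refine DFunLike.ext _ _ fun a => induction_word (p := fun a => ω₁ a = ω₂ a)
    (isClosed_eq ω₁.2 ω₂.2) ?_ (fun a b ha hb => ?_) (fun c a ha => ?_) h a
  · simp only [map_zero]
  · simp only [map_add, ha, hb]
  · simp only [map_smul, ha]

/-- The KMS condition on the elements `V_t V_u^*`. -/
def IsWordKMS (F : Y → ℝ) (β : ℝ) (ω : WeakDual ℂ (CayleyCuntz ev)) : Prop :=
  ∀ (t u : List Y) (h : evalWord ev t = evalWord ev u) (b : CayleyCuntz ev),
    ω (word t u h * b) =
      Real.exp (-β * ((t.map F).sum - (u.map F).sum)) * ω (b * word t u h)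

theorem isWordKMS_of_words {F : Y → ℝ} {β : ℝ} {ω : WeakDual ℂ (CayleyCuntz ev)}
    (H : ∀ (t u : List Y) (h : evalWord ev t = evalWord ev u) (w z : List Y)
      (h' : evalWord ev w = evalWord ev z), ω (word t u h * word w z h') =
      Real.exp (-β * ((t.map F).sum - (u.map F).sum)) * ω (word w z h' * word t u h)) :
    IsWordKMS F β ω := by
  intro t u h b
  have hω : Continuous ω := ω.2
  refine induction_word (p := fun b => ω (word t u h * b) =
      Real.exp (-β * ((t.map F).sum - (u.map F).sum)) * ω (b * word t u h))
    (isClosed_eq (hω.comp (continuous_const_mul _))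
      (continuous_const.mul (hω.comp (continuous_mul_const _)))) ?_ (fun a b ha hb => ?_)
    (fun c a ha => ?_) (fun w z h' => H t u h w z h') b
  · simp only [mul_zero, zero_mul, map_zero]
  · simp only [mul_add, add_mul, map_add, ha, hb]
  · simp only [mul_smul_comm, smul_mul_assoc, map_smul, ha, smul_eq_mul]
    ring

theorem IsWordKMS.isKMSState {F : Y → ℝ} {β : ℝ} {ω : WeakDual ℂ (CayleyCuntz ev)}
    (hω : IsState ω) (H : IsWordKMS F β ω) : IsKMSState (gauge F) β ω := by
  refine ⟨hω, (wordSubalgebra ev).toNonUnitalStarSubalgebra, dense_wordSubalgebra, ?_, ?_⟩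
  · intro r a ha
    have ha' : a ∈ Submodule.span ℂ (words ev) := mem_wordSubalgebra.1 ha
    refine mem_wordSubalgebra.2 (?_ : gauge F r a ∈ Submodule.span ℂ (words ev))
    induction ha' using Submodule.span_induction with
    | mem x hx =>
      obtain ⟨t, u, h, rfl⟩ := hx
      rw [gauge_word]
      exact Submodule.smul_mem _ _ (Submodule.subset_span ⟨t, u, h, rfl⟩)
    | zero => rw [map_zero]; exact Submodule.zero_mem _
    | add x y hx' hy' hx hy =>
      rw [map_add]
      exact Submodule.add_mem _ (hx (mem_wordSubalgebra.2 hx')) (hy (mem_wordSubalgebra.2 hy'))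
    | smul c x hx' hx =>
      rw [map_smul]; exact Submodule.smul_mem _ _ (hx (mem_wordSubalgebra.2 hx'))
  · intro a ha
    suffices h : ∃ f : ℂ → CayleyCuntz ev, IsEntireExtension (gauge F) a f ∧
        ∀ b, ω (a * b) = ω (b * f (β * Complex.I)) by
      obtain ⟨f, hf, hb⟩ := h
      exact ⟨f, hf, fun b _ => hb b⟩
    refine Submodule.span_induction (p := fun a _ => ∃ f : ℂ → CayleyCuntz ev,
      IsEntireExtension (gauge F) a f ∧ ∀ b, ω (a * b) = ω (b * f (β * Complex.I)))
      ?_ ?_ ?_ ?_ (mem_wordSubalgebra.1 ha)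
    · rintro _ ⟨t, u, h, rfl⟩
      -- At `z = iβ` the exponential is the factor `e^{-β(F(t)-F(u))}` of `IsWordKMS`.
      refine ⟨fun z => Complex.exp (Complex.I * z * ((t.map F).sum - (u.map F).sum : ℝ)) •
        word t u h, ⟨?_, fun r => (gauge_word F r t u h).symm⟩, fun b => ?_⟩
      · fun_prop
      · rw [H t u h b, mul_smul_comm, map_smul, smul_eq_mul, Complex.ofReal_exp]
        congr 2
        push_cast
        linear_combination (-(β : ℂ) * ((((t.map F).sum : ℝ) : ℂ) - ((u.map F).sum : ℝ))) *
          Complex.I_mul_I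
    · refine ⟨0, ⟨differentiable_const _, fun r => ?_⟩, fun b => ?_⟩
      · rw [map_zero]; rfl
      · rw [Pi.zero_apply, mul_zero, zero_mul]
    · rintro x y - - ⟨f, hf, hfb⟩ ⟨g, hg, hgb⟩
      refine ⟨f + g, ⟨hf.1.add hg.1, fun r => ?_⟩, fun b => ?_⟩
      · rw [map_add, Pi.add_apply, hf.2, hg.2]
      · rw [Pi.add_apply, mul_add, add_mul, map_add, map_add, hfb, hgb]
    · rintro c x - ⟨f, hf, hfb⟩
      refine ⟨c • f, ⟨hf.1.const_smul c, fun r => ?_⟩, fun b => ?_⟩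
      · rw [map_smul, Pi.smul_apply, hf.2]
      · rw [Pi.smul_apply, mul_smul_comm, smul_mul_assoc, map_smul, map_smul, hfb]

/-- This removes the subalgebra, which may vary with the state, from the KMS condition. The
right-hand side is visibly preserved by convex combinations. -/
theorem isKMSState_gauge_iff {F : Y → ℝ} {β : ℝ} {ω : WeakDual ℂ (CayleyCuntz ev)} :
    IsKMSState (gauge F) β ω ↔ IsState ω ∧ IsWordKMS F β ω :=
  ⟨fun h => ⟨h.1, fun t u htu b => h.apply_mul_of_eigenvector (gauge_add F)
    (fun r => gauge_word F r t u htu) b⟩, fun h => h.2.isKMSState h.1⟩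

end CayleyCuntz

/-! ### Weights of a KMS state and its vanishing off the diagonal. -/

namespace CayleyCuntz

variable {Y : Type u} [Fintype Y] {H : Type*} [Group H] {ev : Y → H}
  {F : Y → ℝ} {β : ℝ} {ω : WeakDual ℂ (CayleyCuntz ev)}

/-- The values `ω(V_t V_t^*)`. -/
noncomputable def weight (ω : WeakDual ℂ (CayleyCuntz ev)) (t : List Y) : ℝ :=
  (ω (rangeProj ev t)).re

theorem weight_nonneg (h : IsState ω) (t : List Y) : 0 ≤ weight ω t := by
  have := (h.1 (rangeProj ev t)).1
  rwa [star_rangeProj, rangeProj_mul_self] at this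

theorem ofReal_weight (h : IsState ω) (t : List Y) : (weight ω t : ℂ) = ω (rangeProj ev t) := by
  have := (h.1 (rangeProj ev t)).2
  rw [star_rangeProj, rangeProj_mul_self] at this
  exact Complex.ext rfl this.symm

theorem weight_nil (h : IsState ω) : weight ω [] = 1 := by
  rw [weight, rangeProj, word_nil, h.2, Complex.one_re]

theorem sum_weight (ω : WeakDual ℂ (CayleyCuntz ev)) (t : List Y) :
    ∑ s, weight ω (t ++ [s]) = weight ω t := by
  simp only [weight]
  rw [← Complex.re_sum, ← map_sum, sum_rangeProj]

theorem weight_append_le (h : IsState ω) (t u : List Y) : weight ω (t ++ u) ≤ weight ω t := by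
  induction u generalizing t with
  | nil => simp
  | cons s u ih =>
    have h1 := ih (t ++ [s])
    rw [List.append_assoc, List.singleton_append] at h1
    refine h1.trans ?_
    rw [← sum_weight ω t]
    exact Finset.single_le_sum (f := fun s => weight ω (t ++ [s]))
      (fun s _ => weight_nonneg h _) (Finset.mem_univ s)

/-- The two products of `V_t V_u^*` and `V_u V_t^*` are the projections `V_t V_t^*` and `V_u V_u^*`.
Consequently `e^{βF(t)}` times the weight of `t` is a function of the group element alone. -/
theorem IsWordKMS.weight_eq (H : IsWordKMS F β ω) {t u : List Y}
    (h : evalWord ev t = evalWord ev u) :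
    weight ω t = Real.exp (-β * ((t.map F).sum - (u.map F).sum)) * weight ω u := by
  have := H t u h (word u t h.symm)
  rw [word_mul, word_mul] at this
  rw [weight, rangeProj, this, Complex.re_ofReal_mul]
  rfl

/-- A loop `x` along which the weight does not decrease can only start where the weight is zero,
because the path may leave `x` and return to where it came from. -/
theorem IsWordKMS.weight_eq_zero [Nontrivial Y] (hgen : ∀ g : H, ∃ t, evalWord ev t = g)
    (hω : IsState ω) (H : IsWordKMS F β ω) (t : List Y) {x : List Y} (hx : x ≠ [])
    (heq : weight ω (t ++ x) = weight ω t) : weight ω t = 0 := by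
  classical
  obtain ⟨a, x, rfl⟩ := List.exists_cons_of_ne_nil hx
  obtain ⟨z, hz⟩ := exists_ne a
  -- The word `tzw` leaves `tx` at the first letter after `t` and has the same value as `t`, so its
  -- weight is a positive multiple of that of `t`.
  obtain ⟨w, hw⟩ := hgen (ev z)⁻¹
  have h1 : weight ω (t ++ [a]) + weight ω (t ++ [z]) ≤ weight ω t := by
    rw [← sum_weight ω t, ← Finset.sum_pair (f := fun s => weight ω (t ++ [s])) hz.symm]
    exact Finset.sum_le_sum_of_subset_of_nonneg (Finset.subset_univ _)
      fun s _ _ => weight_nonneg hω _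
  have h2 := weight_append_le hω (t ++ [a]) x
  have h3 := weight_append_le hω (t ++ [z]) w
  rw [List.append_assoc, List.singleton_append, heq] at h2
  have h4 : evalWord ev (t ++ [z] ++ w) = evalWord ev t := by
    rw [evalWord_append, evalWord_append, evalWord_singleton, hw, mul_inv_cancel_right]
  rw [H.weight_eq h4] at h3
  have h5 := weight_nonneg hω t
  have h6 := Real.exp_pos (-β * (((t ++ [z] ++ w).map F).sum - (t.map F).sum))
  -- The letter `a` already carries all the weight of `t`, so nothing is left for `z`; yet `z`
  -- carries at least `exp(…)` times the weight of `t`.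
  nlinarith

/-- Taking `b = 1` in the KMS relation shows that a nonzero value forces the exponential factor to
be `1`. Then `t` and `tx` have equal weight, which must be zero, and `V_t (V_{tx})^*` is supported
under the null projection `V_t V_t^*`. -/
theorem IsWordKMS.word_append_eq_zero [Nontrivial Y] (hgen : ∀ g : H, ∃ t, evalWord ev t = g)
    (hω : IsState ω) (H : IsWordKMS F β ω) (t : List Y) {x : List Y} (hx : x ≠ [])
    (h : evalWord ev t = evalWord ev (t ++ x)) : ω (word t (t ++ x) h) = 0 := by
  by_contra hne
  have h1 := H t (t ++ x) h 1
  rw [mul_one, one_mul] at h1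
  have h2 : Real.exp (-β * ((t.map F).sum - ((t ++ x).map F).sum)) = 1 := by
    have := mul_right_cancel₀ hne ((one_mul _).trans h1)
    exact_mod_cast this.symm
  have h3 := H.weight_eq h
  rw [h2, one_mul] at h3
  have h4 := H.weight_eq_zero hgen hω t hx h3.symm
  refine hne ?_
  rw [← rangeProj_mul_word]
  refine hω.apply_proj_mul_eq_zero (star_rangeProj t) (rangeProj_mul_self t) ?_ _
  rw [← ofReal_weight hω, h4, Complex.ofReal_zero]

/-- A KMS state vanishes on `V_t V_u^*` when `t ≠ u`. -/
theorem IsWordKMS.word_eq_zero [Nontrivial Y] (hgen : ∀ g : H, ∃ t, evalWord ev t = g)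
    (hω : IsState ω) (H : IsWordKMS F β ω) (t u : List Y)
    (h : evalWord ev t = evalWord ev u) (hne : t ≠ u) : ω (word t u h) = 0 := by
  -- The projection `V_t V_t^*` is fixed by the action, so it can be moved from the left of `V_t
  -- V_u^*` to the right. The product there is zero unless `t` and `u` are comparable.
  have h1 := H t t rfl (word t u h)
  rw [word_mul, sub_self, mul_zero, Real.exp_zero, Complex.ofReal_one, one_mul] at h1
  rcases word_mul_eq_zero_or t u t t h rfl with h0 | ⟨x, hx⟩ | ⟨x, hx⟩
  · rw [h1, h0, map_zero]
  · subst hx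
    have h2 := H.word_append_eq_zero hgen hω u (x := x) (by rintro rfl; simp at hne) h.symm
    rw [← star_word, hω.map_star, star_eq_zero] at h2
    exact h2
  · subst hx
    exact H.word_append_eq_zero hgen hω t (by rintro rfl; simp at hne) h

end CayleyCuntz

/-! ### States given by integration against a measure. -/

section Integration

open MeasureTheory

variable {Y : Type u} [Fintype Y] {H : Type*} [Group H] {ev : Y → H}

theorem integrable_condExpect (m : ProbabilityMeasure (PathSpace Y)) (a : CuntzAlgebra Y) :
    Integrable (fun x => condExpect Y a x) m.toMeasure :=
  (condExpect Y a).continuous.integrable_of_hasCompactSupport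
    (HasCompactSupport.of_compactSpace _)

namespace CayleyCuntz

/-- The functional `a ↦ ∫ E(a) dm`. -/
noncomputable def integralState (ev : Y → H) (m : ProbabilityMeasure (PathSpace Y)) :
    WeakDual ℂ (CayleyCuntz ev) :=
  StrongDual.toWeakDual <| LinearMap.mkContinuous
    { toFun := fun a : CayleyCuntz ev => ∫ x, condExpect Y (incl a) x ∂m.toMeasure
      map_add' := fun a b => by
        rw [← integral_add (integrable_condExpect m _) (integrable_condExpect m _)]
        simp
      map_smul' := fun c a => by
        rw [RingHom.id_apply, smul_eq_mul, ← integral_const_mul]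
        simp } 1
    (fun a => by
      refine (norm_integral_le_of_norm_le_const (C := ‖incl a‖)
        (Filter.Eventually.of_forall fun x => PathRep.norm_diag_le _ _)).trans ?_
      rw [probReal_univ, mul_one, one_mul]
      exact NonUnitalStarAlgHom.norm_apply_le incl a)

theorem integralState_apply (m : ProbabilityMeasure (PathSpace Y)) (a : CayleyCuntz ev) :
    integralState ev m a = ∫ x, condExpect Y (incl a) x ∂m.toMeasure := rfl

open scoped Classical in
theorem integralState_word (m : ProbabilityMeasure (PathSpace Y)) (t u : List Y)
    (h : evalWord ev t = evalWord ev u) :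
    integralState ev m (word t u h) =
      if t = u then ((m.toMeasure.real (PathSpace.cylinder t) : ℝ) : ℂ) else 0 := by
  rw [integralState_apply, incl_word]
  simp only [condExpect_word]
  split_ifs with htu
  · simp only [htu, true_and]
    have : (fun x => if x ∈ PathSpace.cylinder u then (1 : ℂ) else 0) =
        (PathSpace.cylinder u).indicator 1 := by
      funext x; simp [Set.indicator_apply]
    rw [this, integral_indicator (PathSpace.measurableSet_cylinder u)]
    simp
  · simp [htu]

theorem weight_integralState (m : ProbabilityMeasure (PathSpace Y)) (t : List Y) :
    weight (integralState ev m) t = m.toMeasure.real (PathSpace.cylinder t) := by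
  classical
  rw [weight, rangeProj, integralState_word, if_pos rfl, Complex.ofReal_re]

theorem isState_integralState (m : ProbabilityMeasure (PathSpace Y)) :
    IsState (integralState ev m) := by
  refine ⟨fun a => ?_, ?_⟩
  -- Positivity is pointwise: `E(a^*a)(x)` is the squared norm of the image of the basis vector at
  -- `(x, 0)` under `a`.
  · have h (x : PathSpace Y) : condExpect Y (incl (star a * a)) x =
        ((‖PathRep.rep ⟨x 0⟩ (incl a) (PathRep.δ (x, (0 : ℤ)))‖ ^ 2 : ℝ) : ℂ) := by
      change PathRep.diag _ x = _
      rw [PathRep.diag, map_mul, map_mul, starAlgHom_star, starAlgHom_star,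
        mul_apply_eq_comp, ContinuousLinearMap.star_eq_adjoint,
        ContinuousLinearMap.adjoint_inner_right, inner_self_eq_norm_sq_to_K]
      push_cast
      rfl
    rw [integralState_apply]
    simp only [h]
    rw [integral_complex_ofReal, Complex.ofReal_re, Complex.ofReal_im]
    exact ⟨integral_nonneg fun x => sq_nonneg _, rfl⟩
  · classical
    rw [← word_nil, integralState_word, if_pos rfl, PathSpace.cylinder_nil, probReal_univ,
      Complex.ofReal_one]

theorem continuous_integralState : Continuous (integralState (Y := Y) ev) := by
  refine WeakDual.continuous_of_continuous_eval fun a => ?_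
  have hre (f : C(PathSpace Y, ℝ)) : Continuous fun m : ProbabilityMeasure (PathSpace Y) =>
      ∫ x, f x ∂m.toMeasure :=
    ProbabilityMeasure.continuous_integral_boundedContinuousFunction
      (BoundedContinuousFunction.mkOfCompact f)
  have h (m : ProbabilityMeasure (PathSpace Y)) : integralState ev m a =
      ((∫ x, (condExpect Y (incl a) x).re ∂m.toMeasure : ℝ) : ℂ) +
        ((∫ x, (condExpect Y (incl a) x).im ∂m.toMeasure : ℝ) : ℂ) * Complex.I :=
    (integral_re_add_im (integrable_condExpect m (incl a))).symm
  simp only [h]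
  exact (Complex.continuous_ofReal.comp
    (hre ⟨_, Complex.continuous_re.comp (condExpect Y (incl a)).continuous⟩)).add
    ((Complex.continuous_ofReal.comp
      (hre ⟨_, Complex.continuous_im.comp (condExpect Y (incl a)).continuous⟩)).mul
      continuous_const)

theorem integralState_eq_of_weight [Nontrivial Y] (hgen : ∀ g : H, ∃ t, evalWord ev t = g)
    {F : Y → ℝ} {β : ℝ} {ω : WeakDual ℂ (CayleyCuntz ev)} (hω : IsState ω)
    (hK : IsWordKMS F β ω) {m : ProbabilityMeasure (PathSpace Y)}
    (hm : ∀ t, m.toMeasure.real (PathSpace.cylinder t) = weight ω t) :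
    integralState ev m = ω := by
  classical
  refine weakDual_ext fun t u h => ?_
  rw [integralState_word]
  split_ifs with htu
  · subst htu
    rw [hm, ofReal_weight hω]
    rfl
  · exact (hK.word_eq_zero hgen hω t u h htu).symm

/-- If the product of two words in one order has nonzero integral, it is some `V_y V_y^*`. The
product in the other order is then some `V_v V_v^*` with `v̄ = ȳ`, so `ψ` takes the same value at
both and only the exponential factors differ. -/
theorem isWordKMS_integralState {F : Y → ℝ} {β : ℝ} {m : ProbabilityMeasure (PathSpace Y)}
    {ψ : H → ℝ} (hm : ∀ t, m.toMeasure.real (PathSpace.cylinder t) =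
      Real.exp (-β * (t.map F).sum) * ψ (evalWord ev t)) :
    IsWordKMS F β (integralState ev m) := by
  classical
  have key (t u w z : List Y) (h : evalWord ev t = evalWord ev u)
      (h' : evalWord ev w = evalWord ev z)
      (hne : integralState ev m (word t u h * word w z h') ≠ 0) :
      integralState ev m (word t u h * word w z h') =
        Real.exp (-β * ((t.map F).sum - (u.map F).sum)) *
          integralState ev m (word w z h' * word t u h) := by
    have hexp (a b c : ℝ) : Real.exp (-β * (a + c)) =
        Real.exp (-β * (a - b)) * Real.exp (-β * (b + c)) := by
      rw [← Real.exp_add]; ring_nf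
    rcases word_mul_eq_zero_or t u w z h h' with h0 | ⟨x, rfl⟩ | ⟨x, rfl⟩
    · rw [h0, map_zero] at hne
      exact absurd rfl hne
    · rw [word_mul_append, integralState_word] at hne
      obtain rfl : t ++ x = z := by
        by_contra htz
        exact hne (if_neg htz)
      rw [word_mul_append, integralState_word, if_pos rfl, word_append_mul, integralState_word,
        if_pos rfl, hm, hm, ← Complex.ofReal_mul, ← mul_assoc, List.map_append, List.map_append,
        List.sum_append, List.sum_append, ← hexp, evalWord_append, evalWord_append, h]
    · rw [word_append_mul, integralState_word] at hne
      obtain rfl : t = z ++ x := by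
        by_contra htz
        exact hne (if_neg htz)
      rw [word_append_mul, integralState_word, if_pos rfl, word_mul_append, integralState_word,
        if_pos rfl, hm, hm, ← Complex.ofReal_mul, ← mul_assoc, List.map_append, List.map_append,
        List.sum_append, List.sum_append, evalWord_append, evalWord_append, h', ← Real.exp_add]
      ring_nf
  refine isWordKMS_of_words fun t u h w z h' => ?_
  -- `key` assumes that the left-hand side is nonzero. If only the right-hand side is nonzero, `key`
  -- with the two words exchanged shows that it vanishes too.
  by_cases hne : integralState ev m (word t u h * word w z h') = 0
  · by_cases hne' : integralState ev m (word w z h' * word t u h) = 0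
    · rw [hne, hne', mul_zero]
    · rw [key w z t u h' h hne', hne, mul_zero, mul_zero]
  · exact key t u w z h h' hne

end CayleyCuntz

end Integration

/-! ### The correspondence between KMS states, KMS measures and harmonic vectors. -/

section CayleyGraph

open MeasureTheory CayleyCuntz

variable {G : Type u} [Group G] {Y : Finset G} {F : Y → ℝ} {β : ℝ}

/-- The inclusion of the finite set `Y` in the group. -/
abbrev letterEval (Y : Finset G) : Y → G := fun s => (s : G)

theorem exists_evalWord_eq (hgen : Subsemigroup.closure (Y : Set G) = ⊤) (g : G) :
    ∃ t : List Y, evalWord (letterEval Y) t = g := by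
  have hg : g ∈ Subsemigroup.closure (Y : Set G) := hgen ▸ Subsemigroup.mem_top g
  induction hg using Subsemigroup.closure_induction with
  | mem s hs => exact ⟨[⟨s, hs⟩], evalWord_singleton _⟩
  | mul a b _ _ ha hb =>
    obtain ⟨t, rfl⟩ := ha
    obtain ⟨u, rfl⟩ := hb
    exact ⟨t ++ u, evalWord_append t u⟩

theorem mem_kmsStates_iff {ω : WeakDual ℂ (CayleyAlgebra Y)} :
    ω ∈ kmsStates Y F β ↔ IsState ω ∧ IsWordKMS F β ω :=
  isKMSState_gauge_iff

theorem isIntegralState_iff {m : ProbabilityMeasure (PathSpace Y)}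
    {ω : WeakDual ℂ (CayleyAlgebra Y)} :
    IsIntegralState Y m ω ↔ integralState (letterEval Y) m = ω :=
  ⟨fun h => DFunLike.ext _ _ fun a => (h a).symm, fun h a => by rw [← h]; rfl⟩

theorem mem_kmsMeasures_iff {m : ProbabilityMeasure (PathSpace Y)} :
    m ∈ kmsMeasures Y F β ↔ IsWordKMS F β (integralState (letterEval Y) m) := by
  constructor
  · rintro ⟨ω, hω, h⟩
    rw [isIntegralState_iff.1 h]
    exact (mem_kmsStates_iff.1 hω).2
  · exact fun h => ⟨_, mem_kmsStates_iff.2 ⟨isState_integralState m, h⟩,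
      isIntegralState_iff.2 rfl⟩

theorem integralState_mem_kmsStates {m : ProbabilityMeasure (PathSpace Y)}
    (h : m ∈ kmsMeasures Y F β) : integralState (letterEval Y) m ∈ kmsStates Y F β :=
  mem_kmsStates_iff.2 ⟨isState_integralState m, mem_kmsMeasures_iff.1 h⟩

theorem integralState_convexComb (r : unitInterval) (m₁ m₂ : ProbabilityMeasure (PathSpace Y)) :
    integralState (letterEval Y) (convexComb r m₁ m₂) =
      (1 - r : ℝ) • integralState (letterEval Y) m₁ +
        (r : ℝ) • integralState (letterEval Y) m₂ := by
  refine DFunLike.ext _ _ fun a => ?_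
  change ∫ x, condExpect Y (incl a) x ∂(ENNReal.ofReal (1 - r) • m₁.toMeasure +
    ENNReal.ofReal r • m₂.toMeasure) = (1 - r : ℝ) • integralState (letterEval Y) m₁ a +
      (r : ℝ) • integralState (letterEval Y) m₂ a
  rw [integral_add_measure ((integrable_condExpect m₁ _).smul_measure ENNReal.ofReal_ne_top)
    ((integrable_condExpect m₂ _).smul_measure ENNReal.ofReal_ne_top), integral_smul_measure,
    integral_smul_measure, ENNReal.toReal_ofReal (sub_nonneg.2 r.2.2),
    ENNReal.toReal_ofReal r.2.1]
  rfl

theorem measureReal_convexComb {X : Type*} [MeasurableSpace X] (r : unitInterval)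
    (m₁ m₂ : ProbabilityMeasure X) (s : Set X) :
    (convexComb r m₁ m₂).toMeasure.real s =
      (1 - r : ℝ) * m₁.toMeasure.real s + (r : ℝ) * m₂.toMeasure.real s := by
  change (ENNReal.ofReal (1 - r) • m₁.toMeasure + ENNReal.ofReal r • m₂.toMeasure).real s = _
  rw [measureReal_add_apply (by simp [ENNReal.mul_eq_top]) (by simp [ENNReal.mul_eq_top]), measureReal_ennreal_smul_apply,
    measureReal_ennreal_smul_apply, ENNReal.toReal_ofReal (sub_nonneg.2 r.2.2),
    ENNReal.toReal_ofReal r.2.1]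

theorem convex_kmsStates (Y : Finset G) (F : Y → ℝ) (β : ℝ) : Convex ℝ (kmsStates Y F β) := by
  intro ω₁ h₁ ω₂ h₂ a b ha hb hab
  rw [mem_kmsStates_iff] at h₁ h₂ ⊢
  refine ⟨h₁.1.convex_comb h₂.1 ha hb hab, fun t u h x => ?_⟩
  have happ (x : CayleyAlgebra Y) : (a • ω₁ + b • ω₂) x = a * ω₁ x + b * ω₂ x := rfl
  rw [happ, happ, h₁.2, h₂.2]
  ring

theorem convexComb_mem_kmsMeasures {m₁ m₂ : ProbabilityMeasure (PathSpace Y)}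
    (h₁ : m₁ ∈ kmsMeasures Y F β) (h₂ : m₂ ∈ kmsMeasures Y F β) (r : unitInterval) :
    convexComb r m₁ m₂ ∈ kmsMeasures Y F β := by
  refine ⟨_, convex_kmsStates Y F β (integralState_mem_kmsStates h₁)
    (integralState_mem_kmsStates h₂) (sub_nonneg.2 r.2.2) r.2.1 (sub_add_cancel _ _),
    isIntegralState_iff.2 (integralState_convexComb r m₁ m₂)⟩

theorem convex_normalizedHarmonicVectors (Y : Finset G) (F : Y → ℝ) (β : ℝ) :
    Convex ℝ (normalizedHarmonicVectors Y F β) := by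
  rintro ψ₁ ⟨h₁, h₁', h₁''⟩ ψ₂ ⟨h₂, h₂', h₂''⟩ a b ha hb hab
  refine ⟨fun g => add_nonneg (mul_nonneg ha (h₁ g)) (mul_nonneg hb (h₂ g)), fun g => ?_, ?_⟩
  · simp only [Pi.add_apply, Pi.smul_apply, smul_eq_mul]
    rw [← h₁' g, ← h₂' g, Finset.mul_sum, Finset.mul_sum, ← Finset.sum_add_distrib]
    exact Finset.sum_congr rfl fun s _ => by ring
  · simp only [Pi.add_apply, Pi.smul_apply, smul_eq_mul, h₁'', h₂'', mul_one, hab]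

/-- The relation `m(tY^ℕ) = e^{-β F(t)} ψ_{t̄}` between a measure and a function on the group. -/
def IsPotential (F : Y → ℝ) (β : ℝ) (m : ProbabilityMeasure (PathSpace Y)) (ψ : G → ℝ) : Prop :=
  ∀ t : List Y, m.toMeasure.real (PathSpace.cylinder t) =
    Real.exp (-β * (t.map F).sum) * ψ (evalWord (letterEval Y) t)

theorem IsPotential.apply_evalWord {m : ProbabilityMeasure (PathSpace Y)} {ψ : G → ℝ}
    (h : IsPotential F β m ψ) (t : List Y) : ψ (evalWord (letterEval Y) t) =
      Real.exp (β * (t.map F).sum) * m.toMeasure.real (PathSpace.cylinder t) := by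
  rw [h t, ← mul_assoc, ← Real.exp_add]
  simp

theorem IsPotential.mem_kmsMeasures {m : ProbabilityMeasure (PathSpace Y)} {ψ : G → ℝ}
    (h : IsPotential F β m ψ) : m ∈ kmsMeasures Y F β :=
  mem_kmsMeasures_iff.2 (isWordKMS_integralState h)

/-- Every group element is the value of a word, so each property of `ψ` is one of the cylinder
weights: nonnegativity, additivity over the next letter, and total mass one. -/
theorem IsPotential.mem_normalizedHarmonicVectors
    (hgen : Subsemigroup.closure (Y : Set G) = ⊤) {m : ProbabilityMeasure (PathSpace Y)}
    {ψ : G → ℝ} (h : IsPotential F β m ψ) : ψ ∈ normalizedHarmonicVectors Y F β := by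
  refine ⟨fun g => ?_, fun g => ?_, ?_⟩
  · obtain ⟨t, rfl⟩ := exists_evalWord_eq hgen g
    rw [h.apply_evalWord]
    positivity
  · obtain ⟨t, rfl⟩ := exists_evalWord_eq hgen g
    rw [h.apply_evalWord t, ← weight_integralState (ev := letterEval Y), ← sum_weight,
      Finset.mul_sum]
    refine Finset.sum_congr rfl fun s _ => ?_
    have := h.apply_evalWord (t ++ [s])
    rw [evalWord_append, evalWord_singleton] at this
    rw [this, weight_integralState, ← mul_assoc, ← Real.exp_add]
    congr 2
    simp
    ring
  · have := h.apply_evalWord []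
    simpa [PathSpace.cylinder_nil] using this

theorem exists_isPotential_of_mem_kmsMeasures (hgen : Subsemigroup.closure (Y : Set G) = ⊤)
    {m : ProbabilityMeasure (PathSpace Y)} (hm : m ∈ kmsMeasures Y F β) :
    ∃ ψ, IsPotential F β m ψ := by
  -- One word is chosen for each group element; `IsWordKMS.weight_eq` makes the choice irrelevant.
  choose u hu using exists_evalWord_eq hgen
  refine ⟨fun g => Real.exp (β * ((u g).map F).sum) *
    m.toMeasure.real (PathSpace.cylinder (u g)), fun t => ?_⟩
  have := (mem_kmsMeasures_iff.1 hm).weight_eq (hu (evalWord (letterEval Y) t)).symm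
  rw [weight_integralState, weight_integralState] at this
  rw [this, ← mul_assoc, ← Real.exp_add]
  ring_nf

/-- Harmonicity at `t̄`, multiplied by `e^{-βF(t)}`, is the consistency of the prescribed weights at
`t`. -/
theorem exists_isPotential_of_harmonic {ψ : G → ℝ} (hψ : ψ ∈ normalizedHarmonicVectors Y F β) :
    ∃ m, IsPotential F β m ψ := by
  obtain ⟨h0, hsum, h1⟩ := hψ
  refine PathSpace.exists_probabilityMeasure (fun t : List Y => Real.exp (-β * (t.map F).sum) *
    ψ (evalWord (letterEval Y) t)) (fun t => mul_nonneg (Real.exp_pos _).le (h0 _))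
    (by simp [h1]) fun t => ?_
  rw [← hsum, Finset.mul_sum]
  refine Finset.sum_congr rfl fun s _ => ?_
  rw [evalWord_append, evalWord_singleton, ← mul_assoc, ← Real.exp_add]
  congr 2
  simp
  ring

theorem exists_integralState_eq (hgen : Subsemigroup.closure (Y : Set G) = ⊤) [Nontrivial Y]
    {ω : WeakDual ℂ (CayleyAlgebra Y)} (hω : ω ∈ kmsStates Y F β) :
    ∃ m ∈ kmsMeasures Y F β, integralState (letterEval Y) m = ω := by
  obtain ⟨hst, hK⟩ := mem_kmsStates_iff.1 hω
  obtain ⟨m, hm⟩ := PathSpace.exists_probabilityMeasure (weight ω) (weight_nonneg hst)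
    (weight_nil hst) (sum_weight ω)
  have h := integralState_eq_of_weight (exists_evalWord_eq hgen) hst hK hm
  exact ⟨m, ⟨ω, hω, isIntegralState_iff.2 h⟩, h⟩

theorem continuous_kmsMeasures_iff {X : Type*} [TopologicalSpace X] {f : X → kmsMeasures Y F β} :
    Continuous f ↔ ∀ t : List Y, Continuous fun x =>
      (f x : ProbabilityMeasure (PathSpace Y)).toMeasure.real (PathSpace.cylinder t) :=
  Topology.IsInducing.subtypeVal.continuous_iff.trans
    (PathSpace.isClosedEmbedding_measureReal_cylinder.isInducing.continuous_iff.trans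
      continuous_pi_iff)

theorem bijective_integralState (hgen : Subsemigroup.closure (Y : Set G) = ⊤) [Nontrivial Y] :
    Function.Bijective fun m : kmsMeasures Y F β =>
      (⟨integralState (letterEval Y) m, integralState_mem_kmsStates m.2⟩ : kmsStates Y F β) := by
  refine ⟨fun m₁ m₂ h => Subtype.ext (PathSpace.probabilityMeasure_ext fun t => ?_), fun ω => ?_⟩
  · rw [← weight_integralState (ev := letterEval Y), ← weight_integralState (ev := letterEval Y)]
    exact congrArg (weight · t) (congrArg Subtype.val h)
  · obtain ⟨m, hm, h⟩ := exists_integralState_eq hgen ω.2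
    exact ⟨⟨m, hm⟩, Subtype.ext h⟩

/-- The homeomorphism from KMS measures to KMS states. -/
noncomputable def kmsMeasuresHomeoStates (hgen : Subsemigroup.closure (Y : Set G) = ⊤)
    [Nontrivial Y] : kmsMeasures Y F β ≃ₜ kmsStates Y F β where
  toEquiv := Equiv.ofBijective _ (bijective_integralState hgen)
  continuous_toFun :=
    (continuous_integralState.comp continuous_subtype_val).subtype_mk _
  continuous_invFun := by
    -- The cylinder weight at `t` is the real part of `ω` at the fixed element `V_t V_t^*`, hence
    -- weak-* continuous in `ω`.
    refine continuous_kmsMeasures_iff.2 fun t => ?_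
    have h : Continuous fun ω : kmsStates Y F β =>
        weight (ω : WeakDual ℂ (CayleyAlgebra Y)) t :=
      Complex.continuous_re.comp ((WeakDual.eval_continuous _).comp continuous_subtype_val)
    refine h.congr fun ω => ?_
    rw [← weight_integralState (ev := letterEval Y)]
    congr 1
    exact (congrArg Subtype.val 
      (Equiv.ofBijective_apply_symm_apply _ (bijective_integralState hgen) ω)).symm

theorem coe_kmsMeasuresHomeoStates (hgen : Subsemigroup.closure (Y : Set G) = ⊤) [Nontrivial Y]
    (m : kmsMeasures Y F β) :
    (kmsMeasuresHomeoStates hgen m : WeakDual ℂ (CayleyAlgebra Y)) =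
      integralState (letterEval Y) m := rfl

theorem IsPotential.ext (hgen : Subsemigroup.closure (Y : Set G) = ⊤)
    {m : ProbabilityMeasure (PathSpace Y)} {ψ₁ ψ₂ : G → ℝ} (h₁ : IsPotential F β m ψ₁)
    (h₂ : IsPotential F β m ψ₂) : ψ₁ = ψ₂ := by
  funext g
  obtain ⟨t, rfl⟩ := exists_evalWord_eq hgen g
  rw [h₁.apply_evalWord, h₂.apply_evalWord]

/-- `IsPotential` is the graph of the bijection, since each side determines the other. Each cylinder
weight is a constant times a value of `ψ` and conversely, so both directions are continuous. -/
theorem exists_kmsMeasures_homeomorph_harmonic (hgen : Subsemigroup.closure (Y : Set G) = ⊤) :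
    ∃ Ψ : kmsMeasures Y F β ≃ₜ normalizedHarmonicVectors Y F β,
      ∀ m : kmsMeasures Y F β, IsPotential F β m (Ψ m) := by
  choose ψ hψ using fun m : kmsMeasures Y F β => exists_isPotential_of_mem_kmsMeasures hgen m.2
  choose μ hμ using fun φ : normalizedHarmonicVectors Y F β => exists_isPotential_of_harmonic φ.2
  refine ⟨⟨⟨fun m => ⟨ψ m, (hψ m).mem_normalizedHarmonicVectors hgen⟩,
    fun φ => ⟨μ φ, (hμ φ).mem_kmsMeasures⟩, fun m => ?_, fun φ => ?_⟩, ?_, ?_⟩, hψ⟩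
  · refine Subtype.ext (PathSpace.probabilityMeasure_ext fun t => ?_)
    rw [hψ m t]
    exact hμ _ t
  · exact Subtype.ext ((hψ _).ext hgen (hμ φ))
  · refine Continuous.subtype_mk (continuous_pi fun g => ?_) _
    obtain ⟨t, rfl⟩ := exists_evalWord_eq hgen g
    simp only [fun m => (hψ m).apply_evalWord t]
    exact continuous_const.mul
      ((PathSpace.continuous_measureReal_cylinder t).comp continuous_subtype_val)
  · refine continuous_kmsMeasures_iff.2 fun t => ?_
    have h : Continuous fun φ : normalizedHarmonicVectors Y F β =>
        Real.exp (-β * (t.map F).sum) * (φ : G → ℝ) (evalWord (letterEval Y) t) :=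
      continuous_const.mul ((continuous_apply _).comp continuous_subtype_val)
    exact h.congr fun φ => (hμ φ t).symm

theorem IsPotential.convexComb {m₁ m₂ : ProbabilityMeasure (PathSpace Y)} {ψ₁ ψ₂ : G → ℝ}
    (h₁ : IsPotential F β m₁ ψ₁) (h₂ : IsPotential F β m₂ ψ₂) (r : unitInterval) :
    IsPotential F β (convexComb r m₁ m₂) ((1 - r : ℝ) • ψ₁ + (r : ℝ) • ψ₂) := by
  intro t
  rw [measureReal_convexComb, h₁ t, h₂ t]
  simp only [Pi.add_apply, Pi.smul_apply, smul_eq_mul]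
  ring

end CayleyGraph

end Proof

theorem mainTheorem9 {G : Type*} [Group G] (Y : Finset G) (hcard : 2 ≤ Y.card)
    (hgen : Subsemigroup.closure (Y : Set G) = ⊤) (F : Y → ℝ) (β : ℝ) :
    -- the three sets are convex
    Convex ℝ (kmsStates Y F β) ∧
    (∀ m₁ ∈ kmsMeasures Y F β, ∀ m₂ ∈ kmsMeasures Y F β, ∀ r : unitInterval,
      convexComb r m₁ m₂ ∈ kmsMeasures Y F β) ∧
    Convex ℝ (normalizedHarmonicVectors Y F β) ∧
    ∃ (Φ : kmsMeasures Y F β ≃ₜ kmsStates Y F β)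
      (Ψ : kmsMeasures Y F β ≃ₜ normalizedHarmonicVectors Y F β),
      (∀ m : kmsMeasures Y F β, IsIntegralState Y m (Φ m)) ∧
      (∀ (m : kmsMeasures Y F β) (t : List Y),
        (m : MeasureTheory.ProbabilityMeasure (PathSpace Y)).toMeasure.real
            (PathSpace.cylinder t) =
          Real.exp (-β * (t.map F).sum) * (Ψ m : G → ℝ) (t.map (fun s : Y => (s : G))).prod) ∧
      (∀ (m₁ m₂ m : kmsMeasures Y F β) (r : unitInterval),
        (m : MeasureTheory.ProbabilityMeasure (PathSpace Y)) = convexComb r m₁ m₂ →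
          (Φ m : WeakDual ℂ (CayleyAlgebra Y)) =
              (1 - r : ℝ) • (Φ m₁ : WeakDual ℂ (CayleyAlgebra Y)) +
                (r : ℝ) • (Φ m₂ : WeakDual ℂ (CayleyAlgebra Y)) ∧
            (Ψ m : G → ℝ) = (1 - r : ℝ) • (Ψ m₁ : G → ℝ) + (r : ℝ) • (Ψ m₂ : G → ℝ)) := by
  have : Nontrivial Y := Fintype.one_lt_card_iff_nontrivial.1 (by simpa using Nat.lt_of_succ_le hcard)
  obtain ⟨Ψ, hΨ⟩ := exists_kmsMeasures_homeomorph_harmonic (F := F) (β := β) hgen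
  refine ⟨convex_kmsStates Y F β, fun m₁ h₁ m₂ h₂ r => convexComb_mem_kmsMeasures h₁ h₂ r,
    convex_normalizedHarmonicVectors Y F β, kmsMeasuresHomeoStates hgen, Ψ,
    fun m => isIntegralState_iff.2 rfl, fun m t => hΨ m t, fun m₁ m₂ m r hm => ⟨?_, ?_⟩⟩
  · simp only [coe_kmsMeasuresHomeoStates]
    rw [hm, integralState_convexComb]
  -- `IsPotential` is linear in the pair of measure and vector, so both sides are potentials of the
  -- same measure and agree by uniqueness.
  · have h := hΨ m
    rw [hm] at h
    exact h.ext hgen ((hΨ m₁).convexComb (hΨ m₂) r)
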